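/- Consider a single-server queue that opens empty at time $0$ and accepts arrivals until a time $T>0$. Service times are independent and exponential with rate $\mu>0$. There are $M\ge 0$ scheduled customers, who arrive at fixed times $0\le \mathcal T(1)<\mathcal T(2)<\dots<\mathcal T(M)\le T$. The number of walk-in customers is Poisson distributed with mean $\lambda>0$, and each of them independently chooses an arrival time in $[0,T]$ (no early arrivals) according to a common probability distribution $F_e$ on $[0,T]$, which may have atoms. Service is first-come first-served within each class, and scheduled customers have non-preemptive priority over walk-in customers (also over walk-in customers who arrive at the same time); walk-in customers who arrive at the same time are put in uniformly random order. Let $E_w(t)$ be the expected waiting time (until service begins) of a tagged walk-in customer who arrives at time $t\in[0,T]$ when all the others follow $F_e$. Assume that $F_e$ is a (symmetric Nash) equilibrium: there is a constant $E_w\ge 0$ with $E_w(t)\ge E_w$ for all $t\in[0,T]$, and $E_w(t)=E_w$ for $F_e$-almost every $t$. A gap of $F_e$ is an interval $[a,b]\subseteq[0,T]$ with $a<b$ such that $[a,b]=\{x\in[0,T] : F_e(x)=F_e(a)\}$, where $F_e(x)$ denotes the cumulative distribution function. Then: 1. $F_e$ has at most $M+1$ gaps, and each gap starts (has its left end point)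 at one of the points $0,\mathcal T(1),\dots,\mathcal T(M)$. 2. Every scheduled time $\mathcal T(i)$ with $0<\mathcal T(i)<T$ is the starting point of a gap or lies in a gap. (For $M\ge 2$ these are $\mathcal T(2),\dots,\mathcal T(M-1)$, together with $\mathcal T(1)$ when $\mathcal T(1)>0$ and $\mathcal T(M)$ when $\mathcal T(M)<T$.) 3. If no customer is scheduled at time $0$ (for $M\ge1$: if $\mathcal T(1)>0$), then the point $0$ is the starting point of a gap or lies in a gap. -/

import Mathlib

open MeasureTheory ProbabilityTheory Set

/-- Poisson probability mass function with mean `x`. With `x = μ * s` it is the probability that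
exactly `i` services are completed in `s` time units of uninterrupted work at rate `μ`. -/
noncomputable def poisMass (x : ℝ) (i : ℕ) : ℝ :=
  Real.exp (-x) * x ^ i / (i.factorial : ℝ)

/-- Density of the Erlang distribution with shape `n` and rate `μ`. For `n = 0` the distribution is
the unit mass at `0`, which contributes nothing to the truncated mean below. -/
noncomputable def erlangDensity (μ : ℝ) (n : ℕ) (x : ℝ) : ℝ :=
  if n = 0 then 0
  else μ ^ n * x ^ (n - 1) * Real.exp (-(μ * x)) / ((n - 1).factorial : ℝ)

/-- Expected waiting time of a walk-in customer who at time `t` has `n` customers in front of her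
(the one in service included), if the scheduled customers still to come arrive at the times in the
increasing list `l` of times after `t`. While she waits, each arriving scheduled customer moves in
front of her. If `t ∈ [𝒯(k), 𝒯(k+1))` and `l = [𝒯(k+1), …, 𝒯(M)]`, this is `w_{𝒯,k}(n,t)`. -/
noncomputable def waitList (μ : ℝ) : List ℝ → ℝ → ℕ → ℝ
  | [], _, n => (n : ℝ) / μ
  | a :: l, t, n =>
      (∫ x in (0 : ℝ)..(a - t), x * erlangDensity μ n x)
        + ∑ i ∈ Finset.range n,
            poisMass (μ * (a - t)) i * ((a - t) + waitList μ l a (n - i + 1))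

/-- `w_{𝒯,k}(n,t)` for the schedule `S` (increasing in `Fin M`) and the index `k` with
`t ∈ [𝒯(k), 𝒯(k+1))`: the scheduled customers still to come are those scheduled after `t`. -/
noncomputable def expWait {M : ℕ} (μ : ℝ) (S : Fin M → ℝ) (t : ℝ) (n : ℕ) : ℝ :=
  waitList μ ((List.ofFn S).filter (fun a => t < a)) t n

/-- Probability that a system with `m` customers has `n` customers `s` time units later, if nobody
arrives in the meantime (a single server with exponential services at rate `μ`). -/
noncomputable def deathProb (μ s : ℝ) (m n : ℕ) : ℝ :=
  if n = 0 then 1 - ∑ i ∈ Finset.range m, poisMass (μ * s) i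
  else if n ≤ m then poisMass (μ * s) (m - n)
  else 0

/-- Probability of `n` customers in the system at time `t`, if the system starts empty and
customers arrive exactly at the times in the list, which is in decreasing order (latest arrival
first, repetitions allowed) and has no entry after `t`. -/
noncomputable def sizeLaw (μ : ℝ) : List ℝ → ℝ → ℕ → ℝ
  | [], _, n => if n = 0 then 1 else 0
  | a :: l, t, n =>
      ∑ m ∈ Finset.range (l.length + 1), sizeLaw μ l a m * deathProb μ (t - a) (m + 1) n

/-- The arrival times, latest first, of the walk-in customers (arrival times `x`) who come before
`t` and of the scheduled customers (arrival times `S`) who come no later than `t`. -/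
noncomputable def arrivalsUpTo {M k : ℕ} (S : Fin M → ℝ) (x : Fin k → ℝ) (t : ℝ) : List ℝ :=
  ((List.ofFn x).filter (fun a => a < t) ++ (List.ofFn S).filter (fun a => a ≤ t)).insertionSort
    (fun a b => b ≤ a)

/-- `P_n(t)`: the probability that an outside observer at time `t` sees `n` customers in the system
when the number of walk-in customers is Poisson with mean `lam` and their arrival times are
independent with law `F`. A customer scheduled at `t` is counted; walk-in customers who arrive
exactly at `t` (there are some only if `F` has an atom at `t`) are not: see `tiePos`. -/
noncomputable def stateProb {M : ℕ} (lam μ : ℝ) (S : Fin M → ℝ) (F : Measure ℝ) (n : ℕ) (t : ℝ) :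
    ℝ :=
  ∑' k : ℕ, poisMass lam k *
    ∫ x : Fin k → ℝ, sizeLaw μ (arrivalsUpTo S x t) t n ∂(Measure.pi fun _ : Fin k => F)

/-- Probability that exactly `r` of the other walk-in customers who arrive at the same time are put
in front of the tagged one, if their number is Poisson with mean `q` and the order is uniformly
random. For `q = 0` this is `1` at `r = 0` and `0` elsewhere. -/
noncomputable def tiePos (q : ℝ) (r : ℕ) : ℝ :=
  ∑' i : ℕ, if r ≤ i then poisMass q i * (1 / ((i : ℝ) + 1)) else 0

/-- `E_w(t)`: the expected waiting time of a walk-in customer who arrives at time `t` when all the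
other walk-in customers choose their arrival times according to `F`. If `F` has no atom at `t` this
is `∑ n, P_n(t) w(n,t)`. -/
noncomputable def meanWait {M : ℕ} (lam μ : ℝ) (S : Fin M → ℝ) (F : Measure ℝ) (t : ℝ) : ℝ :=
  ∑' n : ℕ, stateProb lam μ S F n t * ∑' r : ℕ, tiePos (lam * F.real {t}) r * expWait μ S t (n + r)

/-- `F` is an equilibrium arrival distribution on `[0,T]` (no early arrivals): for some level `E`,
no arrival time in `[0,T]` has an expected waiting time below `E`, and the arrival times that are
used (those with an atom or a positive density, so `F`-almost all) have exactly `E`. -/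
def IsEquilibrium {M : ℕ} (lam μ T : ℝ) (S : Fin M → ℝ) (F : Measure ℝ) : Prop :=
  IsProbabilityMeasure F ∧ F (Icc 0 T)ᶜ = 0 ∧
    ∃ E : ℝ, 0 ≤ E ∧ (∀ t ∈ Icc 0 T, E ≤ meanWait lam μ S F t) ∧
      ∀ᵐ t ∂F, meanWait lam μ S F t = E

/-- The interval `[a,b]` (with `a < b`) is a gap of `F` in `[0,T]`: a full level set of the
cumulative distribution function on `[0,T]`. -/
def IsGap (T : ℝ) (F : Measure ℝ) (a b : ℝ) : Prop :=
  a < b ∧ Icc a b = {x : ℝ | x ∈ Icc 0 T ∧ cdf F x = cdf F a}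

/-!
The expected wait `meanWait` is not continuous, but it has one-sided limits along times that are not
atoms of `F` (`tendsto_leftWait`, `tendsto_rightWait`), and the whole argument compares these limits
with its values.

* At an atom, and at a scheduled time, the limit from the left is strictly below the value
  (`leftWait_lt_meanWait`). Hence an equilibrium has no atoms in `(0, T]`, and at a scheduled time in
  `(0, T)` the expected wait is strictly above the equilibrium level `E`. There the wait is
  continuous from the right, so nobody comes right after the scheduled time, which therefore lies in
  a gap.
* If nobody is scheduled at `0`, there must be an atom at `0`: otherwise a walk-in customer coming at
  `0` would not wait, so that `E = 0`, whereas most of the walk-in customers have to expect a wait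
  (`meanWait_pos`). Just after the atom the expected wait is strictly above the value at `0`, which
  is `E` (`meanWait_lt_rightWait`, by Poisson thinning), so a gap starts there.
* While nobody arrives, the expected wait is strictly decreasing once somebody may have come
  (`meanWait_lt_of_no_arrivals`). At the start `a > 0` of a gap that is not a scheduled time, the
  wait is `E` by continuity from the left, since times just before `a` are in use; inside the gap it
  would then be below `E`. So each gap starts at `0` or at a scheduled time, and there are at most
  `M + 1` of them.

The analytic input is obtained for fixed arrival times and then carried over to random ones by
monotonicity of the integral and dominated convergence (`poisMix_lt`, `tendsto_poisMix`). For fixed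
arrival times, `sizeLaw` satisfies Kolmogorov's forward equation and `waitList` the backward equation,
so between arrivals the mean wait has the derivative `-(1 - P(server idle))` (`hasDerivAt_lawMean`).
-/

/-! ### Poisson probabilities -/

theorem poisMass_nonneg {x : ℝ} (hx : 0 ≤ x) (i : ℕ) : 0 ≤ poisMass x i := by
  unfold poisMass; positivity

theorem poisMass_pos {x : ℝ} (hx : 0 < x) (i : ℕ) : 0 < poisMass x i := by
  unfold poisMass; positivity

theorem poisMass_index_zero (x : ℝ) : poisMass x 0 = Real.exp (-x) := by
  simp [poisMass]

theorem poisMass_zero (i : ℕ) : poisMass 0 i = if i = 0 then 1 else 0 := by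
  rcases i with _ | i <;> simp [poisMass]

theorem succ_mul_poisMass_succ (x : ℝ) (i : ℕ) :
    ((i : ℝ) + 1) * poisMass x (i + 1) = x * poisMass x i := by
  have h : ((i.factorial : ℕ) : ℝ) ≠ 0 := by exact_mod_cast i.factorial_ne_zero
  have h' : ((i : ℝ) + 1) ≠ 0 := by positivity
  simp only [poisMass, Nat.factorial_succ]
  push_cast
  field_simp
  ring

/-- No sign of `x` is needed: this is the exponential series. -/
theorem hasSum_poisMass (x : ℝ) : HasSum (poisMass x) 1 := by
  have h := (NormedSpace.expSeries_div_hasSum_exp (𝔸 := ℝ) x).mul_left (Real.exp (-x))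
  rw [← Real.exp_eq_exp_ℝ, ← Real.exp_add, neg_add_cancel, Real.exp_zero] at h
  exact h.congr_fun fun i => by simp only [poisMass, mul_div_assoc]

theorem sum_poisMass_le_one {x : ℝ} (hx : 0 ≤ x) (n : ℕ) :
    ∑ i ∈ Finset.range n, poisMass x i ≤ 1 :=
  sum_le_hasSum _ (fun i _ => poisMass_nonneg hx i) (hasSum_poisMass x)

theorem sum_poisMass_lt_one {x : ℝ} (hx : 0 < x) (n : ℕ) :
    ∑ i ∈ Finset.range n, poisMass x i < 1 := by
  have h := sum_poisMass_le_one hx.le (n + 1)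
  rw [Finset.sum_range_succ] at h
  linarith [poisMass_pos hx n]

theorem hasDerivAt_poisMass_index_zero (x : ℝ) :
    HasDerivAt (fun y => poisMass y 0) (-poisMass x 0) x := by
  simp only [poisMass_index_zero]
  simpa using (hasDerivAt_neg x).exp

theorem hasDerivAt_poisMass_succ (x : ℝ) (i : ℕ) :
    HasDerivAt (fun y => poisMass y (i + 1)) (poisMass x i - poisMass x (i + 1)) x := by
  have h : ((i.factorial : ℕ) : ℝ) ≠ 0 := by exact_mod_cast i.factorial_ne_zero
  have h' : ((i : ℝ) + 1) ≠ 0 := by positivity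
  have h1 := (((hasDerivAt_neg x).exp).mul (hasDerivAt_pow (i + 1) x)).div_const
    ((i + 1).factorial : ℝ)
  refine h1.congr_deriv ?_
  simp only [poisMass, Nat.factorial_succ]
  push_cast
  field_simp
  ring_nf

theorem hasDerivAt_sum_poisMass (x : ℝ) (n : ℕ) :
    HasDerivAt (fun y => ∑ i ∈ Finset.range (n + 1), poisMass y i) (-poisMass x n) x := by
  induction n with
  | zero => simpa using hasDerivAt_poisMass_index_zero x
  | succ n ih =>
    simp only [Finset.sum_range_succ _ (n + 1)]
    refine (ih.add (hasDerivAt_poisMass_succ x n)).congr_deriv ?_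
    ring

theorem summable_poisMass_mul (x c : ℝ) : Summable fun i : ℕ => poisMass x i * ((i : ℝ) + c) := by
  have h1 : Summable fun i : ℕ => poisMass x i * (i : ℝ) := by
    rw [← summable_nat_add_iff 1]
    refine ((hasSum_poisMass x).summable.mul_left x).congr fun i => ?_
    rw [← succ_mul_poisMass_succ]; push_cast; ring
  refine (h1.add ((hasSum_poisMass x).summable.mul_right c)).congr fun i => ?_
  ring

/-! ### The transition probabilities of the server between arrivals -/

theorem deathProb_of_lt (μ s : ℝ) {m n : ℕ} (h : m < n) : deathProb μ s m n = 0 := by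
  have h1 : n ≠ 0 := by omega
  simp [deathProb, h1, h]

theorem deathProb_nonneg {μ s : ℝ} (h : 0 ≤ μ * s) (m n : ℕ) : 0 ≤ deathProb μ s m n := by
  unfold deathProb
  split_ifs
  · linarith [sum_poisMass_le_one h m]
  · exact poisMass_nonneg h _
  · exact le_rfl

theorem sum_deathProb (μ s : ℝ) {m N : ℕ} (h : m < N) :
    ∑ n ∈ Finset.range N, deathProb μ s m n = 1 := by
  have h1 : ∑ n ∈ Finset.range N, deathProb μ s m n
      = ∑ n ∈ Finset.range (m + 1), deathProb μ s m n := by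
    refine (Finset.sum_subset (Finset.range_mono h) fun n _ hn => ?_).symm
    exact deathProb_of_lt μ s (by simpa using hn)
  rw [h1, Finset.sum_range_succ', ← Finset.sum_range_reflect (fun i => deathProb μ s m (i + 1))]
  have h2 : ∑ j ∈ Finset.range m, deathProb μ s m (m - 1 - j + 1)
      = ∑ j ∈ Finset.range m, poisMass (μ * s) j := by
    refine Finset.sum_congr rfl fun j hj => ?_
    have hj := Finset.mem_range.1 hj
    have e1 : m - 1 - j + 1 ≤ m := by omega
    have e2 : m - (m - 1 - j + 1) = j := by omega
    simp [deathProb, e1, e2]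
  rw [h2]
  simp [deathProb]

theorem deathProb_time_zero (μ : ℝ) (m n : ℕ) :
    deathProb μ 0 m n = if n = m then 1 else 0 := by
  unfold deathProb
  simp only [mul_zero, poisMass_zero]
  rcases n with _ | n
  · rcases m with _ | m
    · simp
    · simp
  · by_cases h : n + 1 ≤ m
    · have : m - (n + 1) = 0 ↔ n + 1 = m := by omega
      simp [h, this]
    · have : n + 1 ≠ m := by omega
      simp [h, this]

/-- Kolmogorov's forward equation of the pure death process. -/
theorem hasDerivAt_deathProb (μ s : ℝ) (m n : ℕ) :
    HasDerivAt (fun y => deathProb μ y m n)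
      (μ * (deathProb μ s m (n + 1) - if n = 0 then 0 else deathProb μ s m n)) s := by
  have hlin : HasDerivAt (fun y : ℝ => μ * y) μ s := by
    simpa using (hasDerivAt_id s).const_mul μ
  rcases n with _ | n
  · rcases m with _ | m
    · simpa [deathProb] using hasDerivAt_const s (1 : ℝ)
    · have h := ((hasDerivAt_sum_poisMass (μ * s) m).comp s hlin).const_sub 1
      simp only [deathProb, if_true]
      refine h.congr_deriv ?_
      simp
      ring
  · by_cases h : n + 1 ≤ m
    · obtain ⟨j, rfl⟩ := Nat.exists_eq_add_of_le h
      have e : n + 1 + j - (n + 1) = j := by omega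
      simp only [deathProb, e, Nat.succ_ne_zero, if_false, h, if_true]
      rcases j with _ | j
      · have h := (hasDerivAt_poisMass_index_zero (μ * s)).comp s hlin
        refine HasDerivAt.congr_deriv h ?_
        simp [mul_comm]
      · have e1 : n + 1 + 1 ≤ n + 1 + (j + 1) := by omega
        have e2 : n + 1 + (j + 1) - (n + 1 + 1) = j := by omega
        rw [if_pos e1, e2]
        have h := (hasDerivAt_poisMass_succ (μ * s) j).comp s hlin
        exact HasDerivAt.congr_deriv h (mul_comm _ _)
    · have h' : ¬ n + 1 + 1 ≤ m := by omega
      simpa [deathProb, h, h'] using hasDerivAt_const s (0 : ℝ)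

/-! ### The expected wait given the number of customers in front -/

/-- The truncated mean of an Erlang distribution; both sides have the same derivative in `u`. -/
theorem integral_mul_erlangDensity {μ : ℝ} (hμ : μ ≠ 0) (u : ℝ) (n : ℕ) :
    ∫ x in (0 : ℝ)..u, x * erlangDensity μ n x
      = n / μ * (1 - ∑ i ∈ Finset.range (n + 1), poisMass (μ * u) i) := by
  rcases n with _ | n
  · simp [erlangDensity]
  have hd : ∀ x : ℝ, HasDerivAt
      (fun x => ((n + 1 : ℕ) : ℝ) / μ * (1 - ∑ i ∈ Finset.range (n + 1 + 1), poisMass (μ * x) i))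
      (x * erlangDensity μ (n + 1) x) x := by
    intro x
    have hlin : HasDerivAt (fun y : ℝ => μ * y) μ x := by
      simpa using (hasDerivAt_id x).const_mul μ
    have h := ((((hasDerivAt_sum_poisMass (μ * x) (n + 1)).comp x hlin).const_sub 1).const_mul
      (((n + 1 : ℕ) : ℝ) / μ))
    refine h.congr_deriv ?_
    have h0 : ((n.factorial : ℕ) : ℝ) ≠ 0 := by exact_mod_cast n.factorial_ne_zero
    simp only [erlangDensity, poisMass, Nat.succ_ne_zero, if_false, Nat.add_sub_cancel,
      Nat.factorial_succ]
    have h' : ((n : ℝ) + 1) ≠ 0 := by positivity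
    push_cast
    field_simp
    ring
  rw [intervalIntegral.integral_eq_sub_of_hasDerivAt (fun x _ => hd x)]
  · have : ∑ i ∈ Finset.range (n + 1 + 1), poisMass (μ * 0) i = 1 := by
      simp [poisMass_zero]
    rw [this]; ring
  · apply Continuous.intervalIntegrable
    simp only [erlangDensity, Nat.succ_ne_zero, if_false]
    fun_prop

/-- Mean of the minimum of `u` and an Erlang variable with shape `n` and rate `μ`. -/
noncomputable def truncMean (μ u : ℝ) (n : ℕ) : ℝ :=
  n / μ * (1 - ∑ i ∈ Finset.range (n + 1), poisMass (μ * u) i)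
    + u * ∑ i ∈ Finset.range n, poisMass (μ * u) i

/-- Mean of `c j`, where `j` is what remains of `n` customers after `u` time units of service,
on the event that `j` is positive. -/
noncomputable def remMean (μ : ℝ) (c : ℕ → ℝ) (u : ℝ) (n : ℕ) : ℝ :=
  ∑ i ∈ Finset.range n, poisMass (μ * u) i * c (n - i)

/-- The expected wait, split into the time that passes before the next scheduled arrival or the start
of service, whichever is first, and the time after the next scheduled arrival. -/
theorem waitList_cons {μ : ℝ} (hμ : μ ≠ 0) (a : ℝ) (l : List ℝ) (t : ℝ) (n : ℕ) :
    waitList μ (a :: l) t n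
      = truncMean μ (a - t) n + remMean μ (fun j => waitList μ l a (j + 1)) (a - t) n := by
  simp only [waitList, integral_mul_erlangDensity hμ, truncMean, remMean, mul_add,
    Finset.sum_add_distrib, Finset.mul_sum]
  simp only [mul_comm (a - t)]
  ring

theorem truncMean_succ_sub {μ : ℝ} (hμ : μ ≠ 0) (u : ℝ) (n : ℕ) :
    truncMean μ u (n + 1) - truncMean μ u n
      = (1 - ∑ i ∈ Finset.range (n + 1), poisMass (μ * u) i) / μ := by
  have h := succ_mul_poisMass_succ (μ * u) n
  simp only [truncMean, Finset.sum_range_succ _ (n + 1)]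
  rw [Finset.sum_range_succ _ n]
  field_simp
  push_cast
  linear_combination (-1 : ℝ) * h

theorem hasDerivAt_truncMean {μ : ℝ} (hμ : μ ≠ 0) (u : ℝ) (n : ℕ) :
    HasDerivAt (fun u => truncMean μ u n) (∑ i ∈ Finset.range n, poisMass (μ * u) i) u := by
  have hlin : HasDerivAt (fun y : ℝ => μ * y) μ u := by
    simpa using (hasDerivAt_id u).const_mul μ
  unfold truncMean
  rcases n with _ | n
  · simpa using hasDerivAt_const u (0 : ℝ)
  have h1 := ((((hasDerivAt_sum_poisMass (μ * u) (n + 1)).comp u hlin).const_sub 1).const_mul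
      (((n + 1 : ℕ) : ℝ) / μ))
  have h2 := (hasDerivAt_id u).mul ((hasDerivAt_sum_poisMass (μ * u) n).comp u hlin)
  refine (h1.add h2).congr_deriv ?_
  have h := succ_mul_poisMass_succ (μ * u) n
  simp
  field_simp
  linear_combination h

theorem hasDerivAt_remMean_succ (μ : ℝ) (c : ℕ → ℝ) (u : ℝ) (n : ℕ) :
    HasDerivAt (fun u => remMean μ c u (n + 1))
      (μ * (remMean μ c u n - remMean μ c u (n + 1))) u := by
  have hlin : HasDerivAt (fun y : ℝ => μ * y) μ u := by
    simpa using (hasDerivAt_id u).const_mul μ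
  have e : ∀ u, remMean μ c u (n + 1) =
      (∑ i ∈ Finset.range n, poisMass (μ * u) (i + 1) * c (n - i))
        + poisMass (μ * u) 0 * c (n + 1) := by
    intro u
    simp [remMean, Finset.sum_range_succ' _ n]
  simp only [e]
  have h1 : HasDerivAt (fun u => ∑ i ∈ Finset.range n, poisMass (μ * u) (i + 1) * c (n - i))
      (∑ i ∈ Finset.range n, (poisMass (μ * u) i - poisMass (μ * u) (i + 1)) * μ * c (n - i)) u :=
    HasDerivAt.fun_sum fun i _ =>
      ((hasDerivAt_poisMass_succ (μ * u) i).comp u hlin).mul_const _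
  have h2 := ((hasDerivAt_poisMass_index_zero (μ * u)).comp u hlin).mul_const (c (n + 1))
  refine (h1.add h2).congr_deriv ?_
  have e2 : ∑ i ∈ Finset.range n, (poisMass (μ * u) i - poisMass (μ * u) (i + 1)) * μ * c (n - i)
      = μ * (∑ i ∈ Finset.range n, poisMass (μ * u) i * c (n - i)
        - ∑ i ∈ Finset.range n, poisMass (μ * u) (i + 1) * c (n - i)) := by
    rw [← Finset.sum_sub_distrib, Finset.mul_sum]
    exact Finset.sum_congr rfl fun i _ => by ring
  rw [e2, remMean]
  ring

theorem waitList_zero (μ : ℝ) (l : List ℝ) (t : ℝ) : waitList μ l t 0 = 0 := by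
  cases l <;> simp [waitList, erlangDensity]

/-- Kolmogorov's backward equation for the expected wait. It holds at every real `t`, also after the
first entry of `l`, because both sides are analytic expressions in `t`. -/
theorem hasDerivAt_waitList_succ {μ : ℝ} (hμ : μ ≠ 0) (l : List ℝ) (t : ℝ) (n : ℕ) :
    HasDerivAt (fun s => waitList μ l s (n + 1))
      (μ * (waitList μ l t (n + 1) - waitList μ l t n) - 1) t := by
  rcases l with _ | ⟨a, l⟩
  · simp only [waitList]
    refine (hasDerivAt_const t _).congr_deriv ?_
    push_cast
    field_simp
    ring
  · simp only [waitList_cons hμ]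
    have hlin : HasDerivAt (fun s : ℝ => a - s) (-1) t := by
      simpa using (hasDerivAt_id t).const_sub a
    have h := ((hasDerivAt_truncMean hμ (a - t) (n + 1)).comp t hlin).add
      ((hasDerivAt_remMean_succ μ (fun j => waitList μ l a (j + 1)) (a - t) n).comp t hlin)
    refine h.congr_deriv ?_
    have h3 := truncMean_succ_sub hμ (a - t) n
    rw [eq_div_iff hμ] at h3
    linear_combination -h3

theorem continuous_waitList {μ : ℝ} (hμ : μ ≠ 0) (l : List ℝ) (n : ℕ) :
    Continuous fun s => waitList μ l s n := by
  rcases n with _ | n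
  · simpa only [waitList_zero] using continuous_const
  · exact continuous_iff_continuousAt.2 fun t => (hasDerivAt_waitList_succ hμ l t n).continuousAt

/-- When a scheduled customer comes exactly now, she overtakes everybody who is still waiting, but
not a walk-in customer who has found the server idle. -/
theorem waitList_cons_self (μ : ℝ) (a : ℝ) (l : List ℝ) (n : ℕ) :
    waitList μ (a :: l) a n = if n = 0 then 0 else waitList μ l a (n + 1) := by
  rcases n with _ | n
  · simp [waitList_zero]
  · simp [waitList, poisMass_zero]

/-- The time up to `u` and the expected time after `u` add up to the mean of the Erlang
distribution. -/
theorem truncMean_add {μ : ℝ} (hμ : μ ≠ 0) (u : ℝ) (n : ℕ) :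
    truncMean μ u n + remMean μ (fun j => (j : ℝ) / μ) u n = n / μ := by
  have h1 : u * ∑ i ∈ Finset.range n, poisMass (μ * u) i
      = (∑ i ∈ Finset.range (n + 1), poisMass (μ * u) i * i) / μ := by
    rw [Finset.sum_range_succ', eq_div_iff hμ, Finset.mul_sum, Finset.sum_mul]
    simp only [Nat.cast_zero, mul_zero, add_zero]
    refine Finset.sum_congr rfl fun i _ => ?_
    have := succ_mul_poisMass_succ (μ * u) i
    push_cast
    linear_combination -this
  have h2 : remMean μ (fun j => (j : ℝ) / μ) u n
      = (∑ i ∈ Finset.range (n + 1), poisMass (μ * u) i * (n - i)) / μ := by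
    rw [remMean, Finset.sum_range_succ, sub_self, mul_zero, add_zero, Finset.sum_div]
    refine Finset.sum_congr rfl fun i hi => ?_
    rw [Nat.cast_sub (Finset.mem_range.1 hi).le]
    ring
  rw [truncMean, h1, h2]
  simp only [mul_sub, Finset.sum_sub_distrib, ← Finset.sum_mul]
  field_simp
  ring

/-- The expected wait is strictly increasing in the number `n` of customers in front, and bounded by
the mean time to serve them together with all the scheduled customers still to come. -/
theorem waitList_bounds {μ : ℝ} (hμ : 0 < μ) : ∀ (l : List ℝ) (t : ℝ),
    (∀ a ∈ l, t < a) → l.Pairwise (· < ·) →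
    StrictMono (waitList μ l t) ∧ ∀ n, waitList μ l t n ≤ (n + l.length) / μ
  | [], t, _, _ => by
    refine ⟨strictMono_nat_of_lt_succ fun n => ?_, fun n => by simp [waitList]⟩
    simp only [waitList]
    push_cast
    gcongr
    linarith
  | a :: l, t, h1, h2 => by
    have hu : 0 < a - t := sub_pos.2 (h1 a (by simp))
    have hμu : 0 < μ * (a - t) := mul_pos hμ hu
    rw [List.pairwise_cons] at h2
    obtain ⟨hm, hb⟩ := waitList_bounds hμ l a h2.1 h2.2
    have hc0 : ∀ j, 0 ≤ waitList μ l a j := fun j => by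
      rw [← waitList_zero μ l a]; exact hm.monotone (Nat.zero_le j)
    refine ⟨strictMono_nat_of_lt_succ fun n => ?_, fun n => ?_⟩
    · rw [waitList_cons hμ.ne', waitList_cons hμ.ne']
      have h3 := truncMean_succ_sub hμ.ne' (a - t) n
      have h4 : 0 < (1 - ∑ i ∈ Finset.range (n + 1), poisMass (μ * (a - t)) i) / μ :=
        div_pos (sub_pos.2 (sum_poisMass_lt_one hμu _)) hμ
      have h5 : remMean μ (fun j => waitList μ l a (j + 1)) (a - t) n
          ≤ remMean μ (fun j => waitList μ l a (j + 1)) (a - t) (n + 1) := by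
        unfold remMean
        rw [Finset.sum_range_succ]
        have h6 : 0 ≤ poisMass (μ * (a - t)) n * waitList μ l a (n + 1 - n + 1) :=
          mul_nonneg (poisMass_nonneg hμu.le _) (hc0 _)
        refine le_add_of_le_of_nonneg (Finset.sum_le_sum fun i _ => ?_) h6
        exact mul_le_mul_of_nonneg_left (hm.monotone (by omega)) (poisMass_nonneg hμu.le _)
      linarith
    · rw [waitList_cons hμ.ne']
      have h3 := truncMean_add hμ.ne' (a - t) n
      have h4 : remMean μ (fun j => waitList μ l a (j + 1)) (a - t) n
          ≤ remMean μ (fun j => (j : ℝ) / μ) (a - t) n + ((l.length : ℝ) + 1) / μ := by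
        have h5 : ∑ i ∈ Finset.range n, poisMass (μ * (a - t)) i * (((l.length : ℝ) + 1) / μ)
            ≤ ((l.length : ℝ) + 1) / μ := by
          rw [← Finset.sum_mul]
          exact mul_le_of_le_one_left (by positivity) (sum_poisMass_le_one hμu.le n)
        refine le_trans ?_ (add_le_add_right h5 _)
        unfold remMean
        rw [← Finset.sum_add_distrib]
        refine Finset.sum_le_sum fun i _ => ?_
        rw [← mul_add]
        refine mul_le_mul_of_nonneg_left ((hb _).trans (le_of_eq ?_)) (poisMass_nonneg hμu.le _)
        push_cast
        ring
      simp only [List.length_cons]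
      push_cast
      have : ((n : ℝ) + (l.length + 1)) / μ = n / μ + (l.length + 1) / μ := by ring
      linarith

/-! ### The law of the number of customers -/

theorem sizeLaw_of_length_lt (μ : ℝ) : ∀ (L : List ℝ) (t : ℝ) (n : ℕ), L.length < n →
    sizeLaw μ L t n = 0
  | [], t, n, h => by
    have : n ≠ 0 := by rintro rfl; simp at h
    simp [sizeLaw, this]
  | a :: l, t, n, h => by
    refine Finset.sum_eq_zero fun m hm => ?_
    have := Finset.mem_range.1 hm
    rw [deathProb_of_lt _ _ (by simp at h; omega), mul_zero]

theorem sum_sizeLaw (μ : ℝ) : ∀ (L : List ℝ) (t : ℝ) (N : ℕ), L.length < N →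
    ∑ n ∈ Finset.range N, sizeLaw μ L t n = 1
  | [], t, N, h => by
    simp only [sizeLaw]
    rw [Finset.sum_ite_eq']
    simpa [Nat.pos_iff_ne_zero] using h
  | a :: l, t, N, h => by
    simp only [sizeLaw]
    rw [Finset.sum_comm]
    rw [← sum_sizeLaw μ l a (l.length + 1) (Nat.lt_succ_self _)]
    refine Finset.sum_congr rfl fun m hm => ?_
    have := Finset.mem_range.1 hm
    rw [← Finset.mul_sum, sum_deathProb _ _ (by simp at h; omega), mul_one]

theorem sizeLaw_nonneg {μ : ℝ} (hμ : 0 ≤ μ) : ∀ (L : List ℝ) (t : ℝ),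
    L.Pairwise (fun a b => b ≤ a) → (∀ a ∈ L, a ≤ t) → ∀ n, 0 ≤ sizeLaw μ L t n
  | [], t, _, _, n => by simp only [sizeLaw]; split_ifs <;> norm_num
  | a :: l, t, h1, h2, n => by
    rw [List.pairwise_cons] at h1
    exact Finset.sum_nonneg fun m _ => mul_nonneg (sizeLaw_nonneg hμ l a h1.2 h1.1 m)
      (deathProb_nonneg (mul_nonneg hμ (sub_nonneg.2 (h2 a (by simp)))) _ _)

/-- Kolmogorov's forward equation, with no arrival after those in `L`. -/
theorem hasDerivAt_sizeLaw (μ : ℝ) (L : List ℝ) (t : ℝ) (n : ℕ) :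
    HasDerivAt (fun s => sizeLaw μ L s n)
      (μ * (sizeLaw μ L t (n + 1) - if n = 0 then 0 else sizeLaw μ L t n)) t := by
  rcases L with _ | ⟨a, l⟩
  · simp only [sizeLaw]
    refine (hasDerivAt_const t _).congr_deriv ?_
    rcases n with _ | n <;> simp
  · simp only [sizeLaw]
    have hlin : HasDerivAt (fun s : ℝ => s - a) 1 t := (hasDerivAt_id t).sub_const a
    have h := HasDerivAt.fun_sum (u := Finset.range (l.length + 1)) fun m _ =>
      ((hasDerivAt_deathProb μ (t - a) (m + 1) n).comp t hlin).const_mul (sizeLaw μ l a m)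
    refine HasDerivAt.congr_deriv h ?_
    rcases n with _ | n
    · simp only [if_true, sub_zero, mul_one, Finset.mul_sum]
      exact Finset.sum_congr rfl fun m _ => by ring
    · simp only [Nat.succ_ne_zero, if_false, mul_one, ← Finset.sum_sub_distrib, Finset.mul_sum]
      exact Finset.sum_congr rfl fun m _ => by ring

theorem continuous_sizeLaw (μ : ℝ) (L : List ℝ) (n : ℕ) : Continuous fun s => sizeLaw μ L s n :=
  continuous_iff_continuousAt.2 fun t => (hasDerivAt_sizeLaw μ L t n).continuousAt

/-- If all arrivals are strictly in the past, the system is empty with positive probability. -/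
theorem sizeLaw_zero_pos {μ : ℝ} (hμ : 0 < μ) (L : List ℝ) (t : ℝ)
    (h1 : L.Pairwise (fun a b => b ≤ a)) (h2 : ∀ a ∈ L, a < t) : 0 < sizeLaw μ L t 0 := by
  rcases L with _ | ⟨a, l⟩
  · simp [sizeLaw]
  rw [List.pairwise_cons] at h1
  have hd : ∀ m, 0 < deathProb μ (t - a) (m + 1) 0 := fun m => by
    simpa [deathProb] using sum_poisMass_lt_one (mul_pos hμ (sub_pos.2 (h2 a (by simp)))) (m + 1)
  have hp := sizeLaw_nonneg hμ.le l a h1.2 h1.1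
  have hs := sum_sizeLaw μ l a _ (Nat.lt_succ_self _)
  obtain ⟨m, hm, hm'⟩ : ∃ m ∈ Finset.range (l.length + 1), 0 < sizeLaw μ l a m := by
    by_contra! hc
    have := Finset.sum_nonpos hc
    simp only [Nat.succ_eq_add_one] at hs
    linarith
  exact Finset.sum_pos' (fun m _ => mul_nonneg (hp m) (hd m).le) ⟨m, hm, mul_pos hm' (hd m)⟩

theorem sizeLaw_zero_lt_one {μ : ℝ} (hμ : 0 < μ) (L : List ℝ) (t : ℝ) (hL : L ≠ [])
    (h1 : L.Pairwise (fun a b => b ≤ a)) (h2 : ∀ a ∈ L, a ≤ t) : sizeLaw μ L t 0 < 1 := by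
  rcases L with _ | ⟨a, l⟩
  · exact absurd rfl hL
  rw [List.pairwise_cons] at h1
  have hx : 0 ≤ μ * (t - a) := mul_nonneg hμ.le (sub_nonneg.2 (h2 a (by simp)))
  have hs := sum_sizeLaw μ l a (l.length + 1) (Nat.lt_succ_self _)
  have hd : ∀ m, deathProb μ (t - a) (m + 1) 0 ≤ 1 - Real.exp (-(μ * (t - a))) := fun m => by
    have : poisMass (μ * (t - a)) 0 ≤ ∑ i ∈ Finset.range (m + 1), poisMass (μ * (t - a)) i :=
      Finset.single_le_sum (f := poisMass (μ * (t - a))) (fun i _ => poisMass_nonneg hx i) (by simp)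
    rw [poisMass_index_zero] at this
    simp only [deathProb, if_true]
    linarith
  calc sizeLaw μ (a :: l) t 0
      ≤ ∑ m ∈ Finset.range (l.length + 1), sizeLaw μ l a m * (1 - Real.exp (-(μ * (t - a)))) :=
        Finset.sum_le_sum fun m _ =>
          mul_le_mul_of_nonneg_left (hd m) (sizeLaw_nonneg hμ.le l a h1.2 h1.1 m)
    _ = 1 - Real.exp (-(μ * (t - a))) := by rw [← Finset.sum_mul, hs, one_mul]
    _ < 1 := by linarith [Real.exp_pos (-(μ * (t - a)))]

theorem sizeLaw_cons_self_succ (μ : ℝ) (a : ℝ) (l : List ℝ) (n : ℕ) :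
    sizeLaw μ (a :: l) a (n + 1) = sizeLaw μ l a n := by
  simp only [sizeLaw, sub_self, deathProb_time_zero, add_left_inj, mul_ite, mul_one, mul_zero]
  rw [Finset.sum_ite_eq]
  split_ifs with h
  · rfl
  · exact (sizeLaw_of_length_lt μ l a n (by simpa using h)).symm

theorem sizeLaw_cons_self_zero (μ : ℝ) (a : ℝ) (l : List ℝ) : sizeLaw μ (a :: l) a 0 = 0 := by
  simp [sizeLaw, deathProb_time_zero]

/-! ### Means over the number of customers -/

/-- Mean of `g` at the number of customers at time `t`, given the arrival times `L`. -/
noncomputable def lawMean (μ : ℝ) (L : List ℝ) (t : ℝ) (g : ℕ → ℝ) : ℝ :=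
  ∑ n ∈ Finset.range (L.length + 1), sizeLaw μ L t n * g n

theorem lawMean_eq_sum (μ : ℝ) {L : List ℝ} (t : ℝ) (g : ℕ → ℝ) {N : ℕ} (h : L.length < N) :
    lawMean μ L t g = ∑ n ∈ Finset.range N, sizeLaw μ L t n * g n := by
  refine Finset.sum_subset (Finset.range_mono h) fun n _ hn => ?_
  rw [sizeLaw_of_length_lt μ L t n (by simpa using hn), zero_mul]

/-- An arrival at the time of observation adds one customer. -/
theorem lawMean_cons_self (μ : ℝ) (a : ℝ) (l : List ℝ) (g : ℕ → ℝ) :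
    lawMean μ (a :: l) a g = lawMean μ l a fun n => g (n + 1) := by
  simp only [lawMean, List.length_cons]
  rw [Finset.sum_range_succ', sizeLaw_cons_self_zero]
  simp [sizeLaw_cons_self_succ]

theorem lawMean_replicate (μ a : ℝ) (n : ℕ) (g : ℕ → ℝ) :
    lawMean μ (List.replicate n a) a g = g n := by
  induction n generalizing g with
  | zero => simp [lawMean, sizeLaw]
  | succ n ih => rw [List.replicate_succ, lawMean_cons_self, ih]

theorem lawMean_const (μ : ℝ) (L : List ℝ) (t c : ℝ) : lawMean μ L t (fun _ => c) = c := by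
  rw [lawMean, ← Finset.sum_mul, sum_sizeLaw μ L t _ (Nat.lt_succ_self _), one_mul]

theorem lawMean_mono {μ : ℝ} (hμ : 0 ≤ μ) {L : List ℝ} {t : ℝ}
    (h1 : L.Pairwise (fun a b => b ≤ a)) (h2 : ∀ a ∈ L, a ≤ t) {g g' : ℕ → ℝ}
    (h : ∀ n ≤ L.length, g n ≤ g' n) : lawMean μ L t g ≤ lawMean μ L t g' :=
  Finset.sum_le_sum fun n hn => mul_le_mul_of_nonneg_left
    (h n (by simpa [Nat.lt_succ_iff] using hn)) (sizeLaw_nonneg hμ L t h1 h2 n)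

theorem lawMean_lt {μ : ℝ} (hμ : 0 ≤ μ) {L : List ℝ} {t : ℝ}
    (h1 : L.Pairwise (fun a b => b ≤ a)) (h2 : ∀ a ∈ L, a ≤ t) {g g' : ℕ → ℝ}
    (h : ∀ n, g n < g' n) : lawMean μ L t g < lawMean μ L t g' := by
  have hp := sizeLaw_nonneg hμ L t h1 h2
  have hs := sum_sizeLaw μ L t _ (Nat.lt_succ_self _)
  obtain ⟨m, hm, hm'⟩ : ∃ m ∈ Finset.range (L.length + 1), 0 < sizeLaw μ L t m := by
    by_contra! hc
    have := Finset.sum_nonpos hc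
    simp only [Nat.succ_eq_add_one] at hs
    linarith
  exact Finset.sum_lt_sum (fun n _ => mul_le_mul_of_nonneg_left (h n).le (hp n))
    ⟨m, hm, mul_lt_mul_of_pos_left (h m) hm'⟩

theorem lawMean_lt_of_zero {μ : ℝ} (hμ : 0 < μ) {L : List ℝ} {t : ℝ}
    (h1 : L.Pairwise (fun a b => b ≤ a)) (h2 : ∀ a ∈ L, a < t) {g g' : ℕ → ℝ}
    (h : ∀ n, g n ≤ g' n) (h0 : g 0 < g' 0) : lawMean μ L t g < lawMean μ L t g' :=
  Finset.sum_lt_sum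
    (fun n _ => mul_le_mul_of_nonneg_left (h n)
      (sizeLaw_nonneg hμ.le L t h1 (fun a ha => (h2 a ha).le) n))
    ⟨0, by simp, mul_lt_mul_of_pos_left h0 (sizeLaw_zero_pos hμ L t h1 h2)⟩

theorem lawMean_pos {μ : ℝ} (hμ : 0 < μ) {L : List ℝ} {t : ℝ} (hL : L ≠ [])
    (h1 : L.Pairwise (fun a b => b ≤ a)) (h2 : ∀ a ∈ L, a ≤ t) {g : ℕ → ℝ}
    (h : ∀ n, 0 < g (n + 1)) (h0 : 0 ≤ g 0) : 0 < lawMean μ L t g := by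
  have hp := sizeLaw_nonneg hμ.le L t h1 h2
  have hs := sum_sizeLaw μ L t _ (Nat.lt_succ_self _)
  have hl := sizeLaw_zero_lt_one hμ L t hL h1 h2
  rw [Nat.succ_eq_add_one, Finset.sum_range_succ'] at hs
  obtain ⟨m, hm, hm'⟩ : ∃ m ∈ Finset.range L.length, 0 < sizeLaw μ L t (m + 1) := by
    by_contra! hc
    have := Finset.sum_nonpos hc
    linarith
  refine Finset.sum_pos' (fun n _ => ?_) ⟨m + 1, ?_, mul_pos hm' (h m)⟩
  · rcases n with _ | n
    · exact mul_nonneg (hp _) h0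
    · exact mul_nonneg (hp _) (h n).le
  · simpa using hm

/-- Between arrivals the mean wait decreases at a rate equal to the probability that the server is
busy: the forward equation for the law and the backward equation for the wait cancel, up to the
`-1` in the latter. -/
theorem hasDerivAt_lawMean {μ : ℝ} (L : List ℝ) (t : ℝ) (w : ℝ → ℕ → ℝ) (h0 : ∀ s, w s 0 = 0)
    (hw : ∀ n, HasDerivAt (fun s => w s (n + 1)) (μ * (w t (n + 1) - w t n) - 1) t) :
    HasDerivAt (fun s => lawMean μ L s (w s)) (-(1 - sizeLaw μ L t 0)) t := by
  have e : ∀ s, lawMean μ L s (w s)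
      = ∑ n ∈ Finset.range L.length, sizeLaw μ L s (n + 1) * w s (n + 1) := fun s => by
    rw [lawMean, Finset.sum_range_succ', h0, mul_zero, add_zero]
  simp only [e]
  -- The product rule leaves a telescoping sum and minus the probability of a busy server.
  have h := HasDerivAt.fun_sum (u := Finset.range L.length) fun n _ =>
    (hasDerivAt_sizeLaw μ L t (n + 1)).mul (hw n)
  refine HasDerivAt.congr_deriv h ?_
  have hs := sum_sizeLaw μ L t _ (Nat.lt_succ_self _)
  rw [Nat.succ_eq_add_one, Finset.sum_range_succ'] at hs
  have hrw : ∀ n, μ * (sizeLaw μ L t (n + 1 + 1)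
        - if n + 1 = 0 then 0 else sizeLaw μ L t (n + 1)) * w t (n + 1)
      + sizeLaw μ L t (n + 1) * (μ * (w t (n + 1) - w t n) - 1)
      = (μ * (sizeLaw μ L t (n + 1 + 1) * w t (n + 1)) - μ * (sizeLaw μ L t (n + 1) * w t n))
        - sizeLaw μ L t (n + 1) := fun n => by
    rw [if_neg (Nat.succ_ne_zero n)]; ring
  simp only [hrw]
  rw [Finset.sum_sub_distrib,
    Finset.sum_range_sub (fun n => μ * (sizeLaw μ L t (n + 1) * w t n)),
    sizeLaw_of_length_lt μ L t (L.length + 1) (Nat.lt_succ_self _), h0]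
  linarith

theorem continuous_lawMean (μ : ℝ) (L : List ℝ) (w : ℝ → ℕ → ℝ)
    (hw : ∀ n, Continuous fun s => w s n) : Continuous fun s => lawMean μ L s (w s) :=
  continuous_finsetSum _ fun n _ => (continuous_sizeLaw μ L n).mul (hw n)

/-! ### Measurability in the arrival times -/

/-- Random lists that are built from measurable entries by finitely many measurable case
distinctions. Sorting and filtering preserve this property, and it suffices for the measurability
of the functions of lists used here, so that no σ-algebra on `List ℝ` is needed. -/
inductive MeasList {Ω : Type*} [MeasurableSpace Ω] : (Ω → List ℝ) → Prop
  | nil : MeasList fun _ => []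
  | cons {f : Ω → ℝ} {ℓ : Ω → List ℝ} : Measurable f → MeasList ℓ → MeasList fun ω => f ω :: ℓ ω
  | ite {p : Ω → Prop} [DecidablePred p] {ℓ ℓ' : Ω → List ℝ} : MeasurableSet {ω | p ω} →
      MeasList ℓ → MeasList ℓ' → MeasList fun ω => if p ω then ℓ ω else ℓ' ω

namespace MeasList

variable {Ω : Type*} [MeasurableSpace Ω] {ℓ ℓ' : Ω → List ℝ}

theorem exists_length_le (h : MeasList ℓ) : ∃ N, ∀ ω, (ℓ ω).length ≤ N := by
  induction h with
  | nil => exact ⟨0, fun _ => le_rfl⟩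
  | cons _ _ ih =>
    obtain ⟨N, hN⟩ := ih
    exact ⟨N + 1, fun ω => by simpa using hN ω⟩
  | ite _ _ _ ih ih' =>
    obtain ⟨N, hN⟩ := ih
    obtain ⟨N', hN'⟩ := ih'
    refine ⟨max N N', fun ω => ?_⟩
    dsimp only
    split_ifs
    · exact (hN ω).trans (le_max_left _ _)
    · exact (hN' ω).trans (le_max_right _ _)

theorem append (h : MeasList ℓ) (h' : MeasList ℓ') : MeasList fun ω => ℓ ω ++ ℓ' ω := by
  induction h with
  | nil => simpa using h'
  | cons hf _ ih => simpa only [List.cons_append] using ih.cons hf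
  | @ite p _ ℓ₁ ℓ₂ hp _ _ ih ih' =>
    have e : ∀ ω, (if p ω then ℓ₁ ω else ℓ₂ ω) ++ ℓ' ω
        = if p ω then ℓ₁ ω ++ ℓ' ω else ℓ₂ ω ++ ℓ' ω := fun ω => by split_ifs <;> rfl
    simp only [e]
    exact ite hp ih ih'

theorem filter (h : MeasList ℓ) (p : ℝ → Prop) [DecidablePred p] (hp : MeasurableSet {a | p a}) :
    MeasList fun ω => (ℓ ω).filter fun a => p a := by
  induction h with
  | nil => exact nil
  | cons hf _ ih =>
    simp only [List.filter_cons, decide_eq_true_eq]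
    exact ite (hf hp) (cons hf ih) ih
  | ite hq _ _ ih ih' =>
    simp only [apply_ite (List.filter _)]
    exact ite hq ih ih'

theorem orderedInsert (h : MeasList ℓ) {f : Ω → ℝ} (hf : Measurable f) :
    MeasList fun ω => (ℓ ω).orderedInsert (fun a b => b ≤ a) (f ω) := by
  induction h with
  | nil => exact cons hf nil
  | cons hg hl ih =>
    simp only [List.orderedInsert_cons]
    exact ite (measurableSet_le hg hf) (cons hf (cons hg hl)) (cons hg ih)
  | ite hq _ _ ih ih' =>
    simp only [apply_ite (List.orderedInsert _ _)]
    exact ite hq ih ih'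

theorem insertionSort (h : MeasList ℓ) :
    MeasList fun ω => (ℓ ω).insertionSort (fun a b => b ≤ a) := by
  induction h with
  | nil => exact nil
  | cons hg _ ih => exact ih.orderedInsert hg
  | ite hq _ _ ih ih' =>
    simp only [apply_ite (List.insertionSort _)]
    exact ite hq ih ih'

theorem const (l : List ℝ) : MeasList fun _ : Ω => l := by
  induction l with
  | nil => exact nil
  | cons a l ih => exact cons measurable_const ih

theorem ofFn {k : ℕ} {f : Fin k → Ω → ℝ} (hf : ∀ i, Measurable (f i)) :
    MeasList fun ω => List.ofFn fun i => f i ω := by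
  induction k with
  | zero => simpa using nil
  | succ k ih =>
    simp only [List.ofFn_succ]
    exact cons (hf 0) (ih fun i => hf i.succ)

theorem measurable_sizeLaw (h : MeasList ℓ) (μ : ℝ) {τ : Ω → ℝ} (hτ : Measurable τ) (n : ℕ) :
    Measurable fun ω => sizeLaw μ (ℓ ω) (τ ω) n := by
  induction h generalizing τ n with
  | nil => exact measurable_const
  | @cons f ℓ hf hl ih =>
    obtain ⟨N, hN⟩ := hl.exists_length_le
    have e : ∀ ω, sizeLaw μ (f ω :: ℓ ω) (τ ω) n = ∑ m ∈ Finset.range (N + 1),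
        sizeLaw μ (ℓ ω) (f ω) m * deathProb μ (τ ω - f ω) (m + 1) n := fun ω => by
      refine Finset.sum_subset (Finset.range_mono (by simpa using hN ω)) fun m _ hm => ?_
      rw [sizeLaw_of_length_lt _ _ _ _ (by simpa using hm), zero_mul]
    simp only [e]
    refine Finset.measurable_fun_sum _ fun m _ => (ih hf m).mul ?_
    have hc : Continuous fun s => deathProb μ s (m + 1) n :=
      continuous_iff_continuousAt.2 fun t => (hasDerivAt_deathProb μ t _ n).continuousAt
    exact hc.measurable.comp (hτ.sub hf)
  | @ite p _ ℓ ℓ' hq _ _ ih ih' =>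
    have e : ∀ ω, sizeLaw μ (if p ω then ℓ ω else ℓ' ω) (τ ω) n
        = if p ω then sizeLaw μ (ℓ ω) (τ ω) n else sizeLaw μ (ℓ' ω) (τ ω) n := fun ω => by
      split_ifs <;> rfl
    simp only [e]
    exact Measurable.ite hq (ih hτ n) (ih' hτ n)

theorem measurable_lawMean (h : MeasList ℓ) (μ t : ℝ) (g : ℕ → ℝ) :
    Measurable fun ω => lawMean μ (ℓ ω) t g := by
  obtain ⟨N, hN⟩ := h.exists_length_le
  simp only [fun ω => lawMean_eq_sum μ t g (Nat.lt_succ_of_le (hN ω))]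
  exact Finset.measurable_fun_sum _ fun n _ =>
    (h.measurable_sizeLaw μ measurable_const n).mul_const _

end MeasList

/-! ### Means over the arrival times of a Poisson number of customers -/

/-- Mean of `f` at the arrival times of the walk-in customers: their number `k` is Poisson with mean
`lam`, and the times are independent with law `F`. -/
noncomputable def poisMix (lam : ℝ) (F : Measure ℝ) (f : (k : ℕ) → (Fin k → ℝ) → ℝ) : ℝ :=
  ∑' k : ℕ, poisMass lam k * ∫ x, f k x ∂(Measure.pi fun _ : Fin k => F)

theorem poisMix_congr {lam : ℝ} {F : Measure ℝ} {f g : (k : ℕ) → (Fin k → ℝ) → ℝ}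
    (h : ∀ k, ∀ᵐ x ∂(Measure.pi fun _ : Fin k => F), f k x = g k x) :
    poisMix lam F f = poisMix lam F g := by
  unfold poisMix
  congr 1 with k
  rw [integral_congr_ae (h k)]

section poisMix

variable {lam : ℝ} {F : Measure ℝ} [IsProbabilityMeasure F] {f g : (k : ℕ) → (Fin k → ℝ) → ℝ}

theorem integrable_pi_of_bound {k : ℕ} {f : (Fin k → ℝ) → ℝ} (hf : Measurable f) {C : ℝ}
    (h : ∀ x, |f x| ≤ C) : Integrable f (Measure.pi fun _ : Fin k => F) :=
  Integrable.of_bound hf.aestronglyMeasurable C (Filter.Eventually.of_forall h)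

theorem abs_integral_pi_le {k : ℕ} {f : (Fin k → ℝ) → ℝ} {C : ℝ} (h : ∀ x, |f x| ≤ C) :
    |∫ x, f x ∂(Measure.pi fun _ : Fin k => F)| ≤ C := by
  simpa using norm_integral_le_of_norm_le_const (μ := Measure.pi fun _ : Fin k => F) (f := f)
    (C := C) (Filter.Eventually.of_forall h)

theorem summable_poisMix (hlam : 0 ≤ lam) {A c : ℝ} (hb : ∀ k x, |f k x| ≤ A * (k + c)) :
    Summable fun k => poisMass lam k * ∫ x, f k x ∂(Measure.pi fun _ : Fin k => F) := by
  refine ((summable_poisMass_mul lam c).mul_left A).of_norm_bounded fun k => ?_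
  rw [norm_mul, Real.norm_eq_abs, Real.norm_eq_abs, abs_of_nonneg (poisMass_nonneg hlam k)]
  calc _ ≤ poisMass lam k * (A * (k + c)) :=
        mul_le_mul_of_nonneg_left (abs_integral_pi_le (hb k)) (poisMass_nonneg hlam k)
    _ = _ := by ring

/-- Strict monotonicity of the mean. It is enough to have a strict inequality when there is exactly
one walk-in customer and she arrives in a set `B` of positive probability. -/
theorem poisMix_lt (hlam : 0 < lam) (hf : ∀ k, Measurable (f k)) (hg : ∀ k, Measurable (g k))
    {A c : ℝ} (hfb : ∀ k x, |f k x| ≤ A * (k + c)) (hgb : ∀ k x, |g k x| ≤ A * (k + c))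
    (hle : ∀ k, ∀ᵐ x ∂(Measure.pi fun _ : Fin k => F), f k x ≤ g k x)
    {B : Set ℝ} (hB : F B ≠ 0) (hlt : ∀ x : Fin 1 → ℝ, x 0 ∈ B → f 1 x < g 1 x) :
    poisMix lam F f < poisMix lam F g := by
  refine Summable.tsum_lt_tsum (i := 1) (fun k => ?_) ?_ (summable_poisMix hlam.le hfb)
    (summable_poisMix hlam.le hgb)
  · exact mul_le_mul_of_nonneg_left (integral_mono_ae (integrable_pi_of_bound (hf k) (hfb k))
      (integrable_pi_of_bound (hg k) (hgb k)) (hle k)) (poisMass_nonneg hlam.le k)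
  · refine mul_lt_mul_of_pos_left ?_ (poisMass_pos hlam 1)
    rw [← sub_pos, ← integral_sub (integrable_pi_of_bound (hg 1) (hgb 1))
      (integrable_pi_of_bound (hf 1) (hfb 1)), integral_pos_iff_support_of_nonneg_ae]
    · refine lt_of_lt_of_le ?_ (measure_mono (s := univ.pi fun _ : Fin 1 => B) ?_)
      · rw [Measure.pi_pi]
        simpa [pos_iff_ne_zero] using hB
      · intro x hx
        exact (sub_pos.2 (hlt x (hx 0 (mem_univ _)))).ne'
    · filter_upwards [hle 1] with x hx
      simpa using hx
    · exact (integrable_pi_of_bound (hg 1) (hgb 1)).sub (integrable_pi_of_bound (hf 1) (hfb 1))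

/-- Dominated convergence; the bound, linear in the number of customers, is summable against the
Poisson probabilities. -/
theorem tendsto_poisMix (hlam : 0 ≤ lam) {l : Filter ℝ} [l.IsCountablyGenerated]
    {f : ℝ → (k : ℕ) → (Fin k → ℝ) → ℝ} (hf : ∀ s k, Measurable (f s k))
    {A c : ℝ} (hfb : ∀ᶠ s in l, ∀ k x, |f s k x| ≤ A * (k + c))
    (h : ∀ k, ∀ᵐ x ∂(Measure.pi fun _ : Fin k => F), Filter.Tendsto (fun s => f s k x) l
      (nhds (g k x))) :
    Filter.Tendsto (fun s => poisMix lam F (f s)) l (nhds (poisMix lam F g)) := by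
  refine tendsto_tsum_of_dominated_convergence ((summable_poisMass_mul lam c).mul_left A)
    (fun k => ?_) ?_
  · refine Filter.Tendsto.const_mul _ ?_
    refine tendsto_integral_filter_of_dominated_convergence (fun _ => A * (k + c))
      (Filter.Eventually.of_forall fun s => (hf s k).aestronglyMeasurable) ?_
      (integrable_const _) (h k)
    filter_upwards [hfb] with s hs
    exact Filter.Eventually.of_forall (hs k)
  · filter_upwards [hfb] with s hs k
    rw [norm_mul, Real.norm_eq_abs, Real.norm_eq_abs, abs_of_nonneg (poisMass_nonneg hlam k)]
    calc _ ≤ poisMass lam k * (A * (k + c)) :=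
          mul_le_mul_of_nonneg_left (abs_integral_pi_le (hs k)) (poisMass_nonneg hlam k)
      _ = _ := by ring

end poisMix

/-! ### Random order among simultaneous arrivals -/

/-- Tonelli's theorem for double series whose rows are finite. -/
theorem tsum_tsum_eq_tsum_sum_range {f : ℕ → ℕ → ℝ} (h0 : ∀ i r, 0 ≤ f i r) (N : ℕ → ℕ)
    (hN : ∀ i r, N i ≤ r → f i r = 0) (hs : Summable fun i => ∑ r ∈ Finset.range (N i), f i r) :
    ∑' r, ∑' i, f i r = ∑' i, ∑ r ∈ Finset.range (N i), f i r := by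
  have hz : ∀ i, ∀ r ∉ Finset.range (N i), f i r = 0 := fun i r hr => hN i r (by simpa using hr)
  have ht : ∀ i, ∑' r, f i r = ∑ r ∈ Finset.range (N i), f i r := fun i => tsum_eq_sum (hz i)
  have hsum : Summable (Function.uncurry f) := by
    refine (summable_prod_of_nonneg fun x => h0 x.1 x.2).2 ⟨fun i => ?_, ?_⟩
    · exact summable_of_ne_finset_zero (hz i)
    · simpa only [Function.uncurry, ht] using hs
  rw [hsum.tsum_comm]
  exact tsum_congr ht

theorem sum_range_div_le {φ : ℕ → ℝ} (i : ℕ) {C : ℝ} (h : ∀ r ≤ i, φ r ≤ C) :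
    (∑ r ∈ Finset.range (i + 1), φ r) / ((i : ℝ) + 1) ≤ C := by
  rw [div_le_iff₀ (by positivity)]
  calc ∑ r ∈ Finset.range (i + 1), φ r ≤ ∑ r ∈ Finset.range (i + 1), C :=
        Finset.sum_le_sum fun r hr => h r (by simpa [Nat.lt_succ_iff] using hr)
    _ = C * (i + 1) := by simp [mul_comm]

theorem le_sum_range_div {φ : ℕ → ℝ} (i : ℕ) {C : ℝ} (h : ∀ r ≤ i, C ≤ φ r) :
    C ≤ (∑ r ∈ Finset.range (i + 1), φ r) / ((i : ℝ) + 1) := by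
  rw [le_div_iff₀ (by positivity)]
  calc C * (i + 1) = ∑ r ∈ Finset.range (i + 1), C := by simp [mul_comm]
    _ ≤ _ := Finset.sum_le_sum fun r hr => h r (by simpa [Nat.lt_succ_iff] using hr)

section tie

variable {q A c : ℝ} {φ : ℕ → ℝ}

theorem summable_poisMass_mul_of_le (hq : 0 ≤ q) (hφ : ∀ r, 0 ≤ φ r)
    (hb : ∀ r, φ r ≤ A * (r + c)) : Summable fun i => poisMass q i * φ i := by
  refine Summable.of_nonneg_of_le (fun i => mul_nonneg (poisMass_nonneg hq i) (hφ i)) (fun i => ?_)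
    ((summable_poisMass_mul q c).mul_left A)
  calc _ ≤ poisMass q i * (A * (i + c)) :=
        mul_le_mul_of_nonneg_left (hb i) (poisMass_nonneg hq i)
    _ = _ := by ring

theorem average_le (hA : 0 ≤ A) (hb : ∀ r, φ r ≤ A * (r + c)) (i : ℕ) :
    (∑ r ∈ Finset.range (i + 1), φ r) / ((i : ℝ) + 1) ≤ A * (i + c) :=
  sum_range_div_le i fun r hr => (hb r).trans (by gcongr)

theorem summable_average (hq : 0 ≤ q) (hA : 0 ≤ A) (hφ : ∀ r, 0 ≤ φ r)
    (hb : ∀ r, φ r ≤ A * (r + c)) :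
    Summable fun i : ℕ => poisMass q i * ((∑ r ∈ Finset.range (i + 1), φ r) / ((i : ℝ) + 1)) :=
  summable_poisMass_mul_of_le hq (fun i => le_sum_range_div i fun r _ => hφ r)
    (average_le hA hb)

/-- With `i` simultaneous competitors, the number of them put in front is uniform on `0, …, i`. -/
theorem tsum_tiePos_mul (hq : 0 ≤ q) (hA : 0 ≤ A) (hφ : ∀ r, 0 ≤ φ r)
    (hb : ∀ r, φ r ≤ A * (r + c)) :
    ∑' r, tiePos q r * φ r
      = ∑' i : ℕ, poisMass q i * ((∑ r ∈ Finset.range (i + 1), φ r) / ((i : ℝ) + 1)) := by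
  have e1 : ∀ r, tiePos q r * φ r
      = ∑' i : ℕ, if r ≤ i then poisMass q i * (1 / ((i : ℝ) + 1)) * φ r else 0 := fun r => by
    rw [tiePos, ← tsum_mul_right]
    simp only [ite_mul, zero_mul]
  have e2 : ∀ i : ℕ, ∑ r ∈ Finset.range (i + 1),
      (if r ≤ i then poisMass q i * (1 / ((i : ℝ) + 1)) * φ r else 0)
      = poisMass q i * ((∑ r ∈ Finset.range (i + 1), φ r) / ((i : ℝ) + 1)) := fun i => by
    rw [Finset.sum_div, Finset.mul_sum]
    refine Finset.sum_congr rfl fun r hr => ?_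
    rw [if_pos (by simpa [Nat.lt_succ_iff] using hr)]
    ring
  simp only [e1]
  rw [tsum_tsum_eq_tsum_sum_range _ (fun i => i + 1)]
  · exact tsum_congr e2
  · intro i r hr
    exact if_neg (by omega)
  · simp only [e2]
    exact summable_average hq hA hφ hb
  · intro i r
    have := poisMass_nonneg hq i
    have := hφ r
    split_ifs <;> positivity

theorem tsum_tiePos_zero_mul (hA : 0 ≤ A) (hφ : ∀ r, 0 ≤ φ r) (hb : ∀ r, φ r ≤ A * (r + c)) :
    ∑' r, tiePos 0 r * φ r = φ 0 := by
  rw [tsum_tiePos_mul le_rfl hA hφ hb, tsum_eq_single 0]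
  · simp [poisMass_zero]
  · intro i hi
    simp [poisMass_zero, hi]

theorem le_tsum_tiePos_mul (hq : 0 ≤ q) (hA : 0 ≤ A) (hφ : ∀ r, 0 ≤ φ r)
    (hb : ∀ r, φ r ≤ A * (r + c)) (hm : Monotone φ) : φ 0 ≤ ∑' r, tiePos q r * φ r := by
  have h1 : HasSum (fun i => poisMass q i * φ 0) (φ 0) := by
    simpa using (hasSum_poisMass q).mul_right (φ 0)
  rw [tsum_tiePos_mul hq hA hφ hb]
  conv_lhs => rw [← h1.tsum_eq]
  exact Summable.tsum_le_tsum (fun i => mul_le_mul_of_nonneg_left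
    (le_sum_range_div i fun r _ => hm (Nat.zero_le r)) (poisMass_nonneg hq i))
    h1.summable (summable_average hq hA hφ hb)

theorem lt_tsum_tiePos_mul (hq : 0 < q) (hA : 0 ≤ A) (hφ : ∀ r, 0 ≤ φ r)
    (hb : ∀ r, φ r ≤ A * (r + c)) (hm : StrictMono φ) : φ 0 < ∑' r, tiePos q r * φ r := by
  have h1 : HasSum (fun i => poisMass q i * φ 0) (φ 0) := by
    simpa using (hasSum_poisMass q).mul_right (φ 0)
  rw [tsum_tiePos_mul hq.le hA hφ hb]
  conv_lhs => rw [← h1.tsum_eq]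
  refine Summable.tsum_lt_tsum (i := 1) (fun i => mul_le_mul_of_nonneg_left
    (le_sum_range_div i fun r _ => hm.monotone (Nat.zero_le r)) (poisMass_nonneg hq.le i)) ?_
    h1.summable (summable_average hq.le hA hφ hb)
  refine mul_lt_mul_of_pos_left ?_ (poisMass_pos hq 1)
  have := hm (Nat.zero_lt_one)
  simp [Finset.sum_range_succ]
  linarith

/-- Only some of the competitors are put in front, which is strictly better than having all of them
there. -/
theorem tsum_tiePos_mul_lt (hq : 0 < q) (hA : 0 ≤ A) (hφ : ∀ r, 0 ≤ φ r)
    (hb : ∀ r, φ r ≤ A * (r + c)) (hm : StrictMono φ) :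
    ∑' r, tiePos q r * φ r < ∑' i, poisMass q i * φ i := by
  rw [tsum_tiePos_mul hq.le hA hφ hb]
  refine Summable.tsum_lt_tsum (i := 1) (fun i => mul_le_mul_of_nonneg_left
    (sum_range_div_le i fun r hr => hm.monotone hr) (poisMass_nonneg hq.le i)) ?_
    (summable_average hq.le hA hφ hb) (summable_poisMass_mul_of_le hq.le hφ hb)
  refine mul_lt_mul_of_pos_left ?_ (poisMass_pos hq 1)
  have := hm (Nat.zero_lt_one)
  simp [Finset.sum_range_succ]
  linarith

theorem tsum_tiePos_mul_le (hq : 0 ≤ q) (hA : 0 ≤ A) (hφ : ∀ r, 0 ≤ φ r)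
    (hb : ∀ r, φ r ≤ A * (r + c)) :
    ∑' r, tiePos q r * φ r ≤ A * (∑' i : ℕ, poisMass q i * i) + A * c := by
  have h1 : Summable fun i : ℕ => poisMass q i * (i : ℝ) := by
    simpa using summable_poisMass_mul q 0
  have h2 : HasSum (fun i : ℕ => A * (poisMass q i * (i + c)))
      (A * (∑' i : ℕ, poisMass q i * i) + A * c) := by
    have := ((h1.hasSum).add ((hasSum_poisMass q).mul_right c)).mul_left A
    rw [one_mul, mul_add] at this
    exact this.congr_fun fun i => by ring
  rw [tsum_tiePos_mul hq hA hφ hb, ← h2.tsum_eq]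
  refine Summable.tsum_le_tsum (fun i => ?_) (summable_average hq hA hφ hb) h2.summable
  calc _ ≤ poisMass q i * (A * (i + c)) :=
        mul_le_mul_of_nonneg_left (average_le hA hb i) (poisMass_nonneg hq i)
    _ = _ := by ring

end tie

/-! ### The expected wait as a mean over arrival times -/

section wait

variable {M : ℕ} {μ : ℝ} {S : Fin M → ℝ}

theorem length_filter_ofFn_le {k : ℕ} (x : Fin k → ℝ) (p : ℝ → Bool) :
    ((List.ofFn x).filter p).length ≤ k := by
  simpa using List.length_filter_le p (List.ofFn x)

theorem pairwise_filter_ofFn (hS : StrictMono S) (p : ℝ → Bool) :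
    ((List.ofFn S).filter p).Pairwise (· < ·) :=
  List.Pairwise.filter p (List.pairwise_ofFn.2 fun _ _ h => hS h)

theorem expWait_zero (μ : ℝ) (S : Fin M → ℝ) (t : ℝ) : expWait μ S t 0 = 0 := waitList_zero _ _ _

theorem expWait_strictMono (hμ : 0 < μ) (hS : StrictMono S) (t : ℝ) :
    StrictMono (expWait μ S t) :=
  (waitList_bounds hμ _ t (fun a ha => by simpa using (List.mem_filter.1 ha).2)
    (pairwise_filter_ofFn hS _)).1

theorem expWait_nonneg (hμ : 0 < μ) (hS : StrictMono S) (t : ℝ) (n : ℕ) : 0 ≤ expWait μ S t n := by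
  rw [← expWait_zero μ S t]
  exact (expWait_strictMono hμ hS t).monotone (Nat.zero_le n)

theorem expWait_le (hμ : 0 < μ) (hS : StrictMono S) (t : ℝ) (n : ℕ) :
    expWait μ S t n ≤ 1 / μ * (n + M) := by
  refine ((waitList_bounds hμ _ t (fun a ha => by simpa using (List.mem_filter.1 ha).2)
    (pairwise_filter_ofFn hS _)).2 n).trans ?_
  rw [one_div, mul_comm, ← div_eq_mul_inv]
  have : (((List.ofFn S).filter (fun a => t < a)).length : ℝ) ≤ M := by
    exact_mod_cast length_filter_ofFn_le S _
  gcongr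

theorem expWait_add_le (hμ : 0 < μ) (hS : StrictMono S) (t : ℝ) (n r : ℕ) :
    expWait μ S t (n + r) ≤ 1 / μ * (r + (n + M)) := by
  refine (expWait_le hμ hS t (n + r)).trans (le_of_eq ?_)
  push_cast; ring

/-- The arrival times in `X` and `Y` together, latest first. -/
noncomputable def mergeArrivals (X Y : List ℝ) : List ℝ :=
  (X ++ Y).insertionSort (fun a b => b ≤ a)

theorem pairwise_mergeArrivals (X Y : List ℝ) :
    (mergeArrivals X Y).Pairwise (fun a b => b ≤ a) :=
  haveI : Std.Total (fun a b : ℝ => b ≤ a) := ⟨fun a b => le_total b a⟩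
  haveI : IsTrans ℝ (fun a b : ℝ => b ≤ a) := ⟨fun _ _ _ h h' => h'.trans h⟩
  List.pairwise_insertionSort _ _

theorem mem_mergeArrivals {X Y : List ℝ} {a : ℝ} : a ∈ mergeArrivals X Y ↔ a ∈ X ∨ a ∈ Y := by
  simp [mergeArrivals]

theorem length_mergeArrivals (X Y : List ℝ) :
    (mergeArrivals X Y).length = X.length + Y.length := by
  simp [mergeArrivals]

theorem measList_mergeArrivals {k : ℕ} (p : ℝ → Prop) [DecidablePred p]
    (hp : MeasurableSet {a | p a}) (Y : List ℝ) :
    MeasList fun x : Fin k → ℝ => mergeArrivals ((List.ofFn x).filter fun a => p a) Y :=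
  (((MeasList.ofFn fun i => measurable_pi_apply i).filter p hp).append
    (MeasList.const Y)).insertionSort

theorem arrivalsUpTo_eq {k : ℕ} (S : Fin M → ℝ) (x : Fin k → ℝ) (t : ℝ) :
    arrivalsUpTo S x t = mergeArrivals ((List.ofFn x).filter fun a => a < t)
      ((List.ofFn S).filter fun a => a ≤ t) := rfl

theorem length_mergeArrivals_filter_le {k : ℕ} (x : Fin k → ℝ) (S : Fin M → ℝ) (p q : ℝ → Bool) :
    (mergeArrivals ((List.ofFn x).filter p) ((List.ofFn S).filter q)).length ≤ k + M := by
  rw [length_mergeArrivals]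
  exact add_le_add (length_filter_ofFn_le _ _) (length_filter_ofFn_le _ _)

theorem arrivalsUpTo_le {k : ℕ} {S : Fin M → ℝ} {x : Fin k → ℝ} {t : ℝ} :
    ∀ a ∈ arrivalsUpTo S x t, a ≤ t := fun a ha => by
  rw [arrivalsUpTo_eq, mem_mergeArrivals, List.mem_filter, List.mem_filter] at ha
  rcases ha with ha | ha
  · exact (by simpa using ha.2 : a < t).le
  · simpa using ha.2

variable {lam : ℝ} {F : Measure ℝ}

/-- Expected wait of a walk-in customer at time `t` who finds `n` customers that came before her, not
counting the walk-in customers arriving at `t` as well, of whom a random number is put in front of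
her. -/
noncomputable def tagWait (lam μ : ℝ) (S : Fin M → ℝ) (F : Measure ℝ) (t : ℝ) (n : ℕ) : ℝ :=
  ∑' r : ℕ, tiePos (lam * F.real {t}) r * expWait μ S t (n + r)

theorem tagWait_of_measure_zero (hμ : 0 < μ) (hS : StrictMono S) {t : ℝ} (h : F {t} = 0) :
    tagWait lam μ S F t = expWait μ S t := by
  ext n
  have : lam * F.real {t} = 0 := by simp [Measure.real, h]
  rw [tagWait, this, tsum_tiePos_zero_mul (A := 1 / μ) (by positivity)
    (fun r => expWait_nonneg hμ hS t (n + r)) (expWait_add_le hμ hS t n)]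
  rfl

theorem expWait_le_tagWait (hlam : 0 ≤ lam) (hμ : 0 < μ) (hS : StrictMono S) (t : ℝ) (n : ℕ) :
    expWait μ S t n ≤ tagWait lam μ S F t n :=
  le_tsum_tiePos_mul (φ := fun r => expWait μ S t (n + r)) (A := 1 / μ)
    (mul_nonneg hlam measureReal_nonneg) (by positivity)
    (fun r => expWait_nonneg hμ hS t (n + r)) (expWait_add_le hμ hS t n)
    ((expWait_strictMono hμ hS t).monotone.comp fun _ _ h => Nat.add_le_add_left h n)

theorem expWait_lt_tagWait [IsFiniteMeasure F] (hlam : 0 < lam) (hμ : 0 < μ) (hS : StrictMono S)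
    {t : ℝ} (h : F {t} ≠ 0) (n : ℕ) : expWait μ S t n < tagWait lam μ S F t n :=
  lt_tsum_tiePos_mul (φ := fun r => expWait μ S t (n + r)) (A := 1 / μ)
    (mul_pos hlam (by simpa [Measure.real, ENNReal.toReal_pos_iff, pos_iff_ne_zero] using h))
    (by positivity)
    (fun r => expWait_nonneg hμ hS t (n + r)) (expWait_add_le hμ hS t n)
    ((expWait_strictMono hμ hS t).comp fun _ _ h => Nat.add_lt_add_left h n)

theorem exists_tagWait_le (hlam : 0 ≤ lam) (hμ : 0 < μ) (hS : StrictMono S) (t : ℝ) :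
    ∃ K, 0 ≤ K ∧ ∀ n, tagWait lam μ S F t n ≤ 1 / μ * (n + K) := by
  have hq : 0 ≤ lam * F.real {t} := mul_nonneg hlam measureReal_nonneg
  refine ⟨(∑' i : ℕ, poisMass (lam * F.real {t}) i * i) + M, ?_, fun n => ?_⟩
  · have : 0 ≤ ∑' i : ℕ, poisMass (lam * F.real {t}) i * i :=
      tsum_nonneg fun i : ℕ => mul_nonneg (poisMass_nonneg hq i) (Nat.cast_nonneg i)
    positivity
  · refine (tsum_tiePos_mul_le (A := 1 / μ) hq (by positivity)
      (fun r => expWait_nonneg hμ hS t (n + r)) (expWait_add_le hμ hS t n)).trans (le_of_eq ?_)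
    ring

theorem tagWait_nonneg (hlam : 0 ≤ lam) (hμ : 0 < μ) (hS : StrictMono S) (t : ℝ) (n : ℕ) :
    0 ≤ tagWait lam μ S F t n :=
  (expWait_nonneg hμ hS t n).trans (expWait_le_tagWait hlam hμ hS t n)

theorem abs_lawMean_le (hμ : 0 < μ) {k : ℕ} {L : List ℝ} {t : ℝ} {g : ℕ → ℝ} {A c : ℝ}
    (h1 : L.Pairwise (fun a b => b ≤ a)) (h2 : ∀ a ∈ L, a ≤ t)
    (hL : L.length ≤ k + M) (hA : 0 ≤ A) (hg0 : ∀ n, 0 ≤ g n) (hg : ∀ n, g n ≤ A * (n + c)) :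
    |lawMean μ L t g| ≤ A * (k + (M + c)) := by
  rw [abs_of_nonneg]
  · calc lawMean μ L t g ≤ lawMean μ L t (fun _ => A * (k + (M + c))) := by
          refine lawMean_mono hμ.le h1 h2 fun n hn => (hg n).trans ?_
          have : (n : ℝ) ≤ k + M := by exact_mod_cast hn.trans hL
          exact mul_le_mul_of_nonneg_left (by linarith) hA
      _ = _ := lawMean_const _ _ _ _
  · rw [← lawMean_const μ L t 0]
    exact lawMean_mono hμ.le h1 h2 fun n _ => hg0 n

/-- The sum over the number of customers in the system, which is outermost in `meanWait`, can be taken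
innermost, for fixed arrival times. -/
theorem meanWait_eq_poisMix [IsProbabilityMeasure F] (hlam : 0 ≤ lam) (hμ : 0 < μ)
    (hS : StrictMono S) (t : ℝ) :
    meanWait lam μ S F t
      = poisMix lam F fun _ x => lawMean μ (arrivalsUpTo S x t) t (tagWait lam μ S F t) := by
  obtain ⟨K, hK, hb⟩ := exists_tagWait_le (F := F) hlam hμ hS t
  have h0 := tagWait_nonneg (F := F) hlam hμ hS t
  have hlen : ∀ (k : ℕ) (x : Fin k → ℝ), (arrivalsUpTo S x t).length ≤ k + M := fun k x =>
    length_mergeArrivals_filter_le x S _ _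
  have hp : ∀ (k : ℕ) (x : Fin k → ℝ) n, 0 ≤ sizeLaw μ (arrivalsUpTo S x t) t n := fun k x =>
    sizeLaw_nonneg hμ.le _ t (pairwise_mergeArrivals _ _) arrivalsUpTo_le
  have hp1 : ∀ (k : ℕ) (x : Fin k → ℝ) n, sizeLaw μ (arrivalsUpTo S x t) t n ≤ 1 := fun k x n => by
    rw [← sum_sizeLaw μ (arrivalsUpTo S x t) t (max ((arrivalsUpTo S x t).length + 1) (n + 1))
      (by omega)]
    exact Finset.single_le_sum (f := sizeLaw μ (arrivalsUpTo S x t) t) (fun i _ => hp k x i)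
      (by simp)
  have hmeas : ∀ (k : ℕ) n, Measurable fun x : Fin k → ℝ => sizeLaw μ (arrivalsUpTo S x t) t n :=
    fun k n => (measList_mergeArrivals (fun a => a < t) measurableSet_Iio _).measurable_sizeLaw
      μ measurable_const n
  set G := tagWait lam μ S F t with hG
  set f : ℕ → ℕ → ℝ := fun k n => poisMass lam k *
    ((∫ x : Fin k → ℝ, sizeLaw μ (arrivalsUpTo S x t) t n ∂(Measure.pi fun _ : Fin k => F)) * G n)
    with hf
  have e1 : meanWait lam μ S F t = ∑' n, ∑' k, f k n := by
    unfold meanWait stateProb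
    refine tsum_congr fun n => ?_
    change _ * G n = _
    rw [← tsum_mul_right]
    exact tsum_congr fun k => mul_assoc _ _ _
  have e2 : ∀ k, ∑ n ∈ Finset.range (k + M + 1), f k n = poisMass lam k *
      ∫ x : Fin k → ℝ, lawMean μ (arrivalsUpTo S x t) t G ∂(Measure.pi fun _ : Fin k => F) := by
    intro k
    simp only [fun x : Fin k → ℝ => lawMean_eq_sum μ t G (Nat.lt_succ_of_le (hlen k x))]
    rw [integral_finsetSum]
    · rw [Finset.mul_sum]
      refine Finset.sum_congr rfl fun n _ => ?_
      rw [integral_mul_const]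
    · intro n _
      refine (integrable_pi_of_bound (hmeas k n) (C := 1) fun x => ?_).mul_const _
      rw [abs_of_nonneg (hp k x n)]
      exact hp1 k x n
  rw [e1, tsum_tsum_eq_tsum_sum_range _ (fun k => k + M + 1)]
  · exact tsum_congr e2
  · intro k n hn
    have : ∀ x : Fin k → ℝ, sizeLaw μ (arrivalsUpTo S x t) t n = 0 := fun x =>
      sizeLaw_of_length_lt _ _ _ _ (lt_of_le_of_lt (hlen k x) hn)
    simp [hf, this]
  · simp only [e2]
    exact summable_poisMix hlam (f := fun k x => lawMean μ (arrivalsUpTo S x t) t G)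
      (A := 1 / μ) fun k x => abs_lawMean_le hμ (pairwise_mergeArrivals _ _) arrivalsUpTo_le
        (hlen k x) (by positivity) h0 hb
  · intro k n
    exact mul_nonneg (poisMass_nonneg hlam k) (mul_nonneg (integral_nonneg fun x => hp k x n) (h0 n))

end wait

/-! ### Poisson thinning -/

theorem MeasList.measurable_length {Ω : Type*} [MeasurableSpace Ω] {ℓ : Ω → List ℝ}
    (h : MeasList ℓ) (φ : ℕ → ℝ) : Measurable fun ω => φ (ℓ ω).length := by
  induction h generalizing φ with
  | nil => exact measurable_const
  | cons _ _ ih => exact ih fun n => φ (n + 1)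
  | @ite p _ ℓ ℓ' hq _ _ ih ih' =>
    have e : ∀ ω, φ (if p ω then ℓ ω else ℓ' ω).length
        = if p ω then φ (ℓ ω).length else φ (ℓ' ω).length := fun ω => by
      split_ifs <;> rfl
    simp only [e]
    exact Measurable.ite hq (ih φ) (ih' φ)

section thinning

variable {F : Measure ℝ} [IsProbabilityMeasure F] (p : ℝ → Prop) [DecidablePred p]

/-- The number of `k` independent points with law `F` that satisfy `p` is binomial; by induction on
`k`, splitting off the first point and using Pascal's rule. -/
theorem integral_comp_length_filter (hp : MeasurableSet {a | p a}) (k : ℕ) (φ : ℕ → ℝ) :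
    ∫ x : Fin k → ℝ, φ ((List.ofFn x).filter fun a => p a).length ∂(Measure.pi fun _ => F)
      = ∑ ij ∈ Finset.HasAntidiagonal.antidiagonal k, (k.choose ij.1 : ℝ) *
          (F.real {a | p a} ^ ij.1 * (1 - F.real {a | p a}) ^ ij.2 * φ ij.1) := by
  induction k generalizing φ with
  | zero => simp
  | succ k ih =>
    have hbd : ∀ (ψ : ℕ → ℝ) (x : Fin k → ℝ), |ψ ((List.ofFn x).filter fun a => p a).length|
        ≤ ∑ i ∈ Finset.range (k + 1), |ψ i| := fun ψ x =>
      Finset.single_le_sum (f := fun i => |ψ i|) (fun i _ => abs_nonneg _)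
        (Finset.mem_range.2 (Nat.lt_succ_of_le (length_filter_ofFn_le x _)))
    have hms : ∀ ψ : ℕ → ℝ, Measurable fun x : Fin k → ℝ =>
        ψ ((List.ofFn x).filter fun a => p a).length := fun ψ =>
      ((MeasList.ofFn fun i => measurable_pi_apply i).filter p hp).measurable_length ψ
    have hint : ∀ ψ : ℕ → ℝ, Integrable (fun x : Fin k → ℝ =>
        ψ ((List.ofFn x).filter fun a => p a).length) (Measure.pi fun _ => F) := fun ψ =>
      integrable_pi_of_bound (hms ψ) (hbd ψ)
    set P := {a | p a} with hP
    set g : ℝ × (Fin k → ℝ) → ℝ := fun z =>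
      P.indicator 1 z.1 * φ (((List.ofFn z.2).filter fun a => p a).length + 1)
        + Pᶜ.indicator 1 z.1 * φ ((List.ofFn z.2).filter fun a => p a).length with hg
    have h1 : Integrable (P.indicator (1 : ℝ → ℝ)) F := (integrable_const (1 : ℝ)).indicator hp
    have h2 : Integrable (Pᶜ.indicator (1 : ℝ → ℝ)) F :=
      (integrable_const (1 : ℝ)).indicator hp.compl
    have hMP := measurePreserving_piFinSuccAbove (fun _ : Fin (k + 1) => F) 0
    have e : ∀ x : Fin (k + 1) → ℝ, φ ((List.ofFn x).filter fun a => p a).length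
        = g (MeasurableEquiv.piFinSuccAbove (fun _ => ℝ) 0 x) := fun x => by
      have e1 : (MeasurableEquiv.piFinSuccAbove (fun _ => ℝ) 0 x).1 = x 0 := rfl
      have e2 : (MeasurableEquiv.piFinSuccAbove (fun _ => ℝ) 0 x).2 = fun i => x i.succ := rfl
      simp only [hg, e1, e2, List.ofFn_succ, List.filter_cons]
      by_cases hx : p (x 0)
      · have : x 0 ∈ P := hx
        simp [hx, this]
      · have : x 0 ∉ P := hx
        simp [hx, this]
    simp only [e]
    rw [hMP.integral_comp' g]
    simp only [hg]
    rw [integral_add (h1.mul_prod (hint fun n => φ (n + 1))) (h2.mul_prod (hint φ)),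
      integral_prod_mul (P.indicator (1 : ℝ → ℝ)) (fun x : Fin k → ℝ =>
        φ (((List.ofFn x).filter fun a => p a).length + 1)),
      integral_prod_mul (Pᶜ.indicator (1 : ℝ → ℝ)) (fun x : Fin k → ℝ =>
        φ ((List.ofFn x).filter fun a => p a).length),
      integral_indicator_one hp, integral_indicator_one hp.compl, probReal_compl_eq_one_sub hp]
    rw [ih φ, ih fun n => φ (n + 1)]
    rw [Finset.sum_antidiagonal_choose_succ_mul
      (fun i j => F.real P ^ i * (1 - F.real P) ^ j * φ i), add_comm, Finset.mul_sum,
      Finset.mul_sum]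
    congr 1
    · exact Finset.sum_congr rfl fun ij _ => by ring
    · refine Finset.sum_congr rfl fun ij hij => ?_
      rw [← Nat.choose_symm_of_eq_add (Finset.HasAntidiagonal.mem_antidiagonal.1 hij).symm]
      ring

/-- The number of walk-in customers whose arrival time satisfies `p` is Poisson. The proof reads the
binomial mixture as a Cauchy product. -/
theorem poisMix_comp_length_filter (hp : MeasurableSet {a | p a}) {lam : ℝ} (hlam : 0 ≤ lam)
    {φ : ℕ → ℝ} {A c : ℝ} (hφ : ∀ r, 0 ≤ φ r) (hb : ∀ r, φ r ≤ A * (r + c)) :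
    (poisMix lam F fun _ x => φ ((List.ofFn x).filter fun a => p a).length)
      = ∑' i, poisMass (lam * F.real {a | p a}) i * φ i := by
  set q := F.real {a | p a} with hq
  have hq0 : 0 ≤ q := measureReal_nonneg
  have hq1 : 0 ≤ 1 - q := sub_nonneg.2 measureReal_le_one
  have hs1 := summable_poisMass_mul_of_le (mul_nonneg hlam hq0) hφ hb
  have hs2 := (hasSum_poisMass (lam * (1 - q))).summable
  have key := tsum_mul_tsum_eq_tsum_sum_antidiagonal_of_summable_norm hs1.norm hs2.norm
  rw [(hasSum_poisMass (lam * (1 - q))).tsum_eq, mul_one] at key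
  rw [key, poisMix]
  refine tsum_congr fun k => ?_
  rw [integral_comp_length_filter p hp, Finset.mul_sum]
  refine Finset.sum_congr rfl fun ij hij => ?_
  obtain ⟨i, j⟩ := ij
  obtain rfl : i + j = k := Finset.HasAntidiagonal.mem_antidiagonal.1 hij
  have hc := Nat.add_choose_mul_factorial_mul_factorial i j
  rw [← Nat.choose_symm_add] at hc
  have hc' : (((i + j).choose i : ℕ) : ℝ) * i.factorial * j.factorial = (i + j).factorial := by
    exact_mod_cast hc
  have hi : ((i.factorial : ℕ) : ℝ) ≠ 0 := by exact_mod_cast i.factorial_ne_zero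
  have hj : ((j.factorial : ℕ) : ℝ) ≠ 0 := by exact_mod_cast j.factorial_ne_zero
  have hij : (((i + j).factorial : ℕ) : ℝ) ≠ 0 := by exact_mod_cast (i + j).factorial_ne_zero
  have hexp : Real.exp (-lam) = Real.exp (-(lam * q)) * Real.exp (-(lam * (1 - q))) := by
    rw [← Real.exp_add]; congr 1; ring
  simp only [poisMass, ← hq]
  rw [← hc', hexp, mul_pow, mul_pow, pow_add]
  have hch : (((i + j).choose i : ℕ) : ℝ) ≠ 0 := by
    exact_mod_cast (Nat.choose_pos (Nat.le_add_right i j)).ne'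
  field_simp

end thinning

/-! ### One-sided limits of the expected wait -/

section limits

open Filter Topology

theorem eventually_filter_ofFn_eq {k : ℕ} (x : Fin k → ℝ) {l : Filter ℝ} {p : ℝ → ℝ → Prop}
    {q : ℝ → Prop} [∀ s, DecidablePred (p s)] [DecidablePred q]
    (h : ∀ a, ∀ᶠ s in l, (p s a ↔ q a)) :
    ∀ᶠ s in l, ((List.ofFn x).filter fun a => p s a) = (List.ofFn x).filter fun a => q a := by
  have : ∀ᶠ s in l, ∀ i, (p s (x i) ↔ q (x i)) := eventually_all.2 fun i => h (x i)
  filter_upwards [this] with s hs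
  refine List.filter_congr fun a ha => ?_
  obtain ⟨i, rfl⟩ := (List.mem_ofFn' x a).1 ha
  simp [hs i]

theorem eventually_left_lt_iff (t a : ℝ) : ∀ᶠ s in 𝓝[<] t, (a < s ↔ a < t) := by
  rcases lt_or_ge a t with h | h
  · filter_upwards [nhdsWithin_le_nhds (lt_mem_nhds h)] with s hs
    exact iff_of_true hs h
  · filter_upwards [self_mem_nhdsWithin] with s hs
    exact iff_of_false ((le_of_lt hs).trans h).not_gt h.not_gt

theorem eventually_left_le_iff (t a : ℝ) : ∀ᶠ s in 𝓝[<] t, (a ≤ s ↔ a < t) := by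
  rcases lt_or_ge a t with h | h
  · filter_upwards [nhdsWithin_le_nhds (lt_mem_nhds h)] with s hs
    exact iff_of_true (le_of_lt hs) h
  · filter_upwards [self_mem_nhdsWithin] with s hs
    exact iff_of_false (lt_of_lt_of_le hs h).not_ge h.not_gt

theorem eventually_right_lt_iff (t a : ℝ) : ∀ᶠ s in 𝓝[>] t, (a < s ↔ a ≤ t) := by
  rcases lt_or_ge t a with h | h
  · filter_upwards [nhdsWithin_le_nhds (gt_mem_nhds h)] with s hs
    exact iff_of_false (le_of_lt hs).not_gt h.not_ge
  · filter_upwards [self_mem_nhdsWithin] with s hs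
    exact iff_of_true (lt_of_le_of_lt h hs) h

theorem eventually_right_le_iff (t a : ℝ) : ∀ᶠ s in 𝓝[>] t, (a ≤ s ↔ a ≤ t) := by
  rcases lt_or_ge t a with h | h
  · filter_upwards [nhdsWithin_le_nhds (gt_mem_nhds h)] with s hs
    exact iff_of_false (lt_of_lt_of_le hs le_rfl).not_ge h.not_ge
  · filter_upwards [self_mem_nhdsWithin] with s hs
    exact iff_of_true (h.trans (le_of_lt hs)) h

theorem ae_pi_forall {F : Measure ℝ} [IsProbabilityMeasure F] {p : ℝ → Prop} (h : ∀ᵐ a ∂F, p a)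
    (k : ℕ) : ∀ᵐ x ∂(Measure.pi fun _ : Fin k => F), ∀ i, p (x i) :=
  eventually_all.2 fun i =>
    (Measure.quasiMeasurePreserving_eval (fun _ : Fin k => F) i).ae h

/-- The arrival times strictly before `t`, latest first. -/
noncomputable def arrivalsBefore {M k : ℕ} (S : Fin M → ℝ) (x : Fin k → ℝ) (t : ℝ) : List ℝ :=
  mergeArrivals ((List.ofFn x).filter fun a => a < t) ((List.ofFn S).filter fun a => a < t)

/-- The arrival times up to and including `t`, latest first. Unlike `arrivalsUpTo` it contains the
walk-in customers who arrive exactly at `t`. -/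
noncomputable def arrivalsThrough {M k : ℕ} (S : Fin M → ℝ) (x : Fin k → ℝ) (t : ℝ) : List ℝ :=
  mergeArrivals ((List.ofFn x).filter fun a => a ≤ t) ((List.ofFn S).filter fun a => a ≤ t)

/-- The limit of the expected wait from the left, at times that are not atoms: what a walk-in customer
expects at time `t` if she is put in front of everybody else arriving at `t`, but can still be
overtaken by a customer scheduled at `t`. -/
noncomputable def leftWait {M : ℕ} (lam μ : ℝ) (S : Fin M → ℝ) (F : Measure ℝ) (t : ℝ) : ℝ :=
  poisMix lam F fun _ x => lawMean μ (arrivalsBefore S x t) t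
    (waitList μ ((List.ofFn S).filter fun a => t ≤ a) t)

/-- The limit of the expected wait from the right, at times that are not atoms: what a walk-in
customer expects at time `t` if she is put behind everybody else arriving at `t`. -/
noncomputable def rightWait {M : ℕ} (lam μ : ℝ) (S : Fin M → ℝ) (F : Measure ℝ) (t : ℝ) : ℝ :=
  poisMix lam F fun _ x => lawMean μ (arrivalsThrough S x t) t (expWait μ S t)

section oneSided

variable {M k : ℕ} {lam μ t : ℝ} {S : Fin M → ℝ} {F : Measure ℝ}

theorem arrivalsBefore_lt {x : Fin k → ℝ} : ∀ a ∈ arrivalsBefore S x t, a < t := fun a ha => by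
  rw [arrivalsBefore, mem_mergeArrivals, List.mem_filter, List.mem_filter] at ha
  simpa using ha.elim And.right And.right

theorem arrivalsThrough_le {x : Fin k → ℝ} : ∀ a ∈ arrivalsThrough S x t, a ≤ t := fun a ha => by
  rw [arrivalsThrough, mem_mergeArrivals, List.mem_filter, List.mem_filter] at ha
  simpa using ha.elim And.right And.right

theorem measurable_lawMean_arrivalsUpTo (μ : ℝ) (S : Fin M → ℝ) (t s : ℝ) (g : ℕ → ℝ) (k : ℕ) :
    Measurable fun x : Fin k → ℝ => lawMean μ (arrivalsUpTo S x t) s g :=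
  (measList_mergeArrivals (fun a => a < t) measurableSet_Iio _).measurable_lawMean μ s g

theorem measurable_lawMean_arrivalsBefore (μ : ℝ) (S : Fin M → ℝ) (t s : ℝ) (g : ℕ → ℝ) (k : ℕ) :
    Measurable fun x : Fin k → ℝ => lawMean μ (arrivalsBefore S x t) s g :=
  (measList_mergeArrivals (fun a => a < t) measurableSet_Iio _).measurable_lawMean μ s g

theorem abs_lawMean_arrivalsUpTo_le (hμ : 0 < μ) (x : Fin k → ℝ) {g : ℕ → ℝ} {c : ℝ}
    (hg0 : ∀ n, 0 ≤ g n) (hg : ∀ n, g n ≤ 1 / μ * (n + c)) (hs : ∀ a ∈ arrivalsUpTo S x t, a ≤ s) :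
    |lawMean μ (arrivalsUpTo S x t) s g| ≤ 1 / μ * (k + (M + c)) :=
  abs_lawMean_le hμ (pairwise_mergeArrivals _ _) hs (length_mergeArrivals_filter_le x S _ _)
    (by positivity) hg0 hg

theorem meanWait_of_measure_zero [IsProbabilityMeasure F] (hlam : 0 ≤ lam) (hμ : 0 < μ)
    (hS : StrictMono S) (h : F {t} = 0) : meanWait lam μ S F t
      = poisMix lam F fun _ x => lawMean μ (arrivalsUpTo S x t) t (expWait μ S t) := by
  rw [meanWait_eq_poisMix hlam hμ hS, tagWait_of_measure_zero hμ hS h]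

/-- For fixed arrival times, the customers who come before `s` and those scheduled later do not change
when `s` is close enough to `t`. Atoms are avoided, as random order among simultaneous arrivals
plays no role outside of them. -/
theorem tendsto_leftWait [IsProbabilityMeasure F] (hlam : 0 ≤ lam) (hμ : 0 < μ)
    (hS : StrictMono S) (t : ℝ) :
    Tendsto (meanWait lam μ S F) (𝓝[<] t ⊓ 𝓟 {s | F {s} = 0}) (𝓝 (leftWait lam μ S F t)) := by
  refine Tendsto.congr' (f₁ := fun s => poisMix lam F fun _ x =>
    lawMean μ (arrivalsUpTo S x s) s (expWait μ S s)) ?_ ?_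
  · filter_upwards [mem_inf_of_right (mem_principal_self _)] with s hs
    exact (meanWait_of_measure_zero hlam hμ hS hs).symm
  refine Tendsto.mono_left ?_ inf_le_left
  refine tendsto_poisMix hlam (A := 1 / μ) (c := M + M)
    (fun s k => measurable_lawMean_arrivalsUpTo μ S s s _ k)
    (Eventually.of_forall fun s k x => abs_lawMean_arrivalsUpTo_le hμ x (expWait_nonneg hμ hS s)
      (expWait_le hμ hS s) arrivalsUpTo_le) fun k => Eventually.of_forall fun x => ?_
  have hc := (continuous_lawMean μ (arrivalsBefore S x t)
    (waitList μ ((List.ofFn S).filter fun a => t ≤ a)) fun n =>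
      continuous_waitList hμ.ne' _ n).tendsto t
  refine (hc.mono_left nhdsWithin_le_nhds).congr' ?_
  filter_upwards [eventually_filter_ofFn_eq x (eventually_left_lt_iff t),
    eventually_filter_ofFn_eq S (eventually_left_le_iff t),
    eventually_filter_ofFn_eq S (p := fun s a => s < a) (q := fun a => t ≤ a) fun a =>
      (eventually_left_le_iff t a).mono fun s h => by rw [← not_le, h, not_lt]] with s h1 h2 h3
  rw [arrivalsUpTo_eq, h1, h2]
  unfold expWait
  rw [h3]
  rfl

theorem tendsto_rightWait [IsProbabilityMeasure F] (hlam : 0 ≤ lam) (hμ : 0 < μ)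
    (hS : StrictMono S) (t : ℝ) :
    Tendsto (meanWait lam μ S F) (𝓝[>] t ⊓ 𝓟 {s | F {s} = 0}) (𝓝 (rightWait lam μ S F t)) := by
  refine Tendsto.congr' (f₁ := fun s => poisMix lam F fun _ x =>
    lawMean μ (arrivalsUpTo S x s) s (expWait μ S s)) ?_ ?_
  · filter_upwards [mem_inf_of_right (mem_principal_self _)] with s hs
    exact (meanWait_of_measure_zero hlam hμ hS hs).symm
  refine Tendsto.mono_left ?_ inf_le_left
  refine tendsto_poisMix hlam (A := 1 / μ) (c := M + M)
    (fun s k => measurable_lawMean_arrivalsUpTo μ S s s _ k)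
    (Eventually.of_forall fun s k x => abs_lawMean_arrivalsUpTo_le hμ x (expWait_nonneg hμ hS s)
      (expWait_le hμ hS s) arrivalsUpTo_le) fun k => Eventually.of_forall fun x => ?_
  have hc := (continuous_lawMean μ (arrivalsThrough S x t)
    (waitList μ ((List.ofFn S).filter fun a => t < a)) fun n =>
      continuous_waitList hμ.ne' _ n).tendsto t
  refine (hc.mono_left nhdsWithin_le_nhds).congr' ?_
  filter_upwards [eventually_filter_ofFn_eq x (eventually_right_lt_iff t),
    eventually_filter_ofFn_eq S (eventually_right_le_iff t),
    eventually_filter_ofFn_eq S (p := fun s a => s < a) (q := fun a => t < a) fun a =>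
      (eventually_right_le_iff t a).mono fun s h => by rw [← not_le, h, not_le]] with s h1 h2 h3
  rw [arrivalsUpTo_eq, h1, h2]
  unfold expWait
  rw [h3]
  rfl

theorem arrivalsUpTo_eq_cons (hS : StrictMono S) (i : Fin M) (x : Fin k → ℝ) :
    arrivalsUpTo S x (S i) = S i :: arrivalsBefore S x (S i) := by
  have hnd : (List.ofFn S).Nodup := List.nodup_ofFn.2 hS.injective
  have hperm : ((List.ofFn S).filter fun a => a ≤ S i).Perm
      (S i :: (List.ofFn S).filter fun a => a < S i) := by
    refine (List.perm_ext_iff_of_nodup (hnd.filter _) ?_).2 fun a => ?_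
    · exact List.nodup_cons.2 ⟨by simp, hnd.filter _⟩
    · simp only [List.mem_filter, List.mem_cons, decide_eq_true_eq, List.mem_ofFn', mem_range,
        le_iff_eq_or_lt]
      constructor
      · rintro ⟨h, rfl | h'⟩
        · exact Or.inl rfl
        · exact Or.inr ⟨h, h'⟩
      · rintro (rfl | h)
        · exact ⟨⟨i, rfl⟩, Or.inl rfl⟩
        · exact ⟨h.1, Or.inr h.2⟩
  refine List.Perm.eq_of_pairwise (le := fun a b : ℝ => b ≤ a)
    (fun a b _ _ h h' => le_antisymm h' h) (pairwise_mergeArrivals _ _) ?_ ?_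
  · exact List.pairwise_cons.2 ⟨fun a ha => (arrivalsBefore_lt a ha).le,
      pairwise_mergeArrivals _ _⟩
  · refine (List.perm_insertionSort _ _).trans ?_
    refine (List.Perm.append_left _ hperm).trans ?_
    exact List.perm_middle.trans ((List.perm_insertionSort _ _).symm.cons _)

theorem filter_le_ofFn_eq_cons (hS : StrictMono S) (i : Fin M) :
    ((List.ofFn S).filter fun a => S i ≤ a) = S i :: (List.ofFn S).filter fun a => S i < a := by
  have hnd : (List.ofFn S).Nodup := List.nodup_ofFn.2 hS.injective
  refine List.Perm.eq_of_pairwise (le := fun a b : ℝ => a < b)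
    (fun a b _ _ h h' => absurd h h'.not_gt) (pairwise_filter_ofFn hS _) ?_ ?_
  · exact List.pairwise_cons.2 ⟨fun a ha => by simpa using (List.mem_filter.1 ha).2,
      pairwise_filter_ofFn hS _⟩
  · refine (List.perm_ext_iff_of_nodup (hnd.filter _) ?_).2 fun a => ?_
    · exact List.nodup_cons.2 ⟨by simp, hnd.filter _⟩
    · simp only [List.mem_filter, List.mem_cons, decide_eq_true_eq, List.mem_ofFn', mem_range,
        le_iff_eq_or_lt]
      constructor
      · rintro ⟨h, h' | h'⟩
        · exact Or.inl h'.symm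
        · exact Or.inr ⟨h, h'⟩
      · rintro (rfl | h)
        · exact ⟨⟨i, rfl⟩, Or.inl rfl⟩
        · exact ⟨h.1, Or.inr h.2⟩

theorem filter_le_eq_filter_lt (h : ∀ i, S i ≠ t) :
    ((List.ofFn S).filter fun a => a ≤ t) = (List.ofFn S).filter fun a => a < t := by
  refine List.filter_congr fun a ha => ?_
  obtain ⟨i, rfl⟩ := (List.mem_ofFn' S a).1 ha
  simp [le_iff_lt_or_eq, h i]

theorem filter_ge_eq_filter_gt (h : ∀ i, S i ≠ t) :
    ((List.ofFn S).filter fun a => t ≤ a) = (List.ofFn S).filter fun a => t < a := by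
  refine List.filter_congr fun a ha => ?_
  obtain ⟨i, rfl⟩ := (List.mem_ofFn' S a).1 ha
  simp [le_iff_lt_or_eq, (h i).symm]

theorem leftWait_eq_meanWait [IsProbabilityMeasure F] (hlam : 0 ≤ lam) (hμ : 0 < μ)
    (hS : StrictMono S) (h : F {t} = 0) (ht : ∀ i, S i ≠ t) :
    leftWait lam μ S F t = meanWait lam μ S F t := by
  rw [meanWait_of_measure_zero hlam hμ hS h, leftWait, filter_ge_eq_filter_gt ht]
  unfold arrivalsBefore
  rw [← filter_le_eq_filter_lt ht]
  rfl

theorem rightWait_eq_meanWait [IsProbabilityMeasure F] (hlam : 0 ≤ lam) (hμ : 0 < μ)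
    (hS : StrictMono S) (h : F {t} = 0) :
    rightWait lam μ S F t = meanWait lam μ S F t := by
  rw [meanWait_of_measure_zero hlam hμ hS h, rightWait]
  refine poisMix_congr fun k => ?_
  have hae : ∀ᵐ a ∂F, a ≠ t := by simpa [ae_iff] using h
  filter_upwards [ae_pi_forall hae k] with x hx
  rw [arrivalsThrough, filter_le_eq_filter_lt hx]
  rfl

theorem waitList_filter_le_nonneg (hμ : 0 < μ) (hS : StrictMono S) (t : ℝ) (n : ℕ) :
    0 ≤ waitList μ ((List.ofFn S).filter fun a => t ≤ a) t n := by
  by_cases hi : ∃ i, S i = t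
  · obtain ⟨i, rfl⟩ := hi
    rw [filter_le_ofFn_eq_cons hS, waitList_cons_self]
    split_ifs
    · exact le_rfl
    · exact expWait_nonneg hμ hS _ _
  · rw [filter_ge_eq_filter_gt fun i hi' => hi ⟨i, hi'⟩]
    exact expWait_nonneg hμ hS _ _

/-- The expected wait jumps upwards at each scheduled time and at each atom: in the first case because
a walk-in customer coming just before `t` may find the server idle, in the second because she is
certainly in front of the walk-in customers who come at `t`. -/
theorem leftWait_lt_meanWait [IsProbabilityMeasure F] (hlam : 0 < lam) (hμ : 0 < μ)
    (hS : StrictMono S) (h : F {t} ≠ 0 ∨ ∃ i, S i = t) :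
    leftWait lam μ S F t < meanWait lam μ S F t := by
  obtain ⟨K, hK, hb⟩ := exists_tagWait_le (F := F) hlam.le hμ hS t
  have h0 := tagWait_nonneg (F := F) hlam.le hμ hS t
  have hwt := expWait_le_tagWait (F := F) hlam.le hμ hS t
  have hlt : ∀ (k : ℕ) (x : Fin k → ℝ), lawMean μ (arrivalsBefore S x t) t
      (waitList μ ((List.ofFn S).filter fun a => t ≤ a) t)
        < lawMean μ (arrivalsUpTo S x t) t (tagWait lam μ S F t) := by
    intro k x
    by_cases hi : ∃ i, S i = t
    · obtain ⟨i, rfl⟩ := hi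
      rw [arrivalsUpTo_eq_cons hS, lawMean_cons_self, filter_le_ofFn_eq_cons hS]
      have hpos : 0 < tagWait lam μ S F (S i) (0 + 1) := by
        refine lt_of_lt_of_le ?_ (hwt _)
        rw [← expWait_zero μ S (S i)]
        exact expWait_strictMono hμ hS _ (by simp)
      refine lawMean_lt_of_zero hμ (pairwise_mergeArrivals _ _) arrivalsBefore_lt (fun n => ?_) ?_
      · rw [waitList_cons_self]
        split_ifs with hn
        · exact h0 _
        · exact hwt (n + 1)
      · rw [waitList_zero]
        exact hpos
    · have ht : ∀ i, S i ≠ t := fun i hi' => hi ⟨i, hi'⟩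
      have hF : F {t} ≠ 0 := h.resolve_right hi
      have e : arrivalsUpTo S x t = arrivalsBefore S x t := by
        rw [arrivalsUpTo_eq, filter_le_eq_filter_lt ht]
        rfl
      rw [e, filter_ge_eq_filter_gt ht]
      exact lawMean_lt hμ.le (pairwise_mergeArrivals _ _) (fun a ha => (arrivalsBefore_lt a ha).le)
        (expWait_lt_tagWait hlam hμ hS hF)
  have hub : ∀ (k : ℕ) (x : Fin k → ℝ), |lawMean μ (arrivalsUpTo S x t) t (tagWait lam μ S F t)|
      ≤ 1 / μ * (k + (M + K)) := fun k x => abs_lawMean_arrivalsUpTo_le hμ x h0 hb arrivalsUpTo_le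
  rw [meanWait_eq_poisMix hlam.le hμ hS, leftWait]
  refine poisMix_lt hlam (fun k => measurable_lawMean_arrivalsBefore μ S t t _ k)
    (fun k => measurable_lawMean_arrivalsUpTo μ S t t _ k) (A := 1 / μ) (c := M + K)
    (fun k x => ?_) hub (fun k => Eventually.of_forall fun x => (hlt k x).le) (B := univ)
    (by simp) (fun x _ => hlt 1 x)
  have hnn : 0 ≤ lawMean μ (arrivalsBefore S x t) t
      (waitList μ ((List.ofFn S).filter fun a => t ≤ a) t) := by
    rw [← lawMean_const μ (arrivalsBefore S x t) t 0]
    exact lawMean_mono hμ.le (pairwise_mergeArrivals _ _) (fun a ha => (arrivalsBefore_lt a ha).le)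
      fun n _ => waitList_filter_le_nonneg hμ hS t n
  rw [abs_of_nonneg hnn]
  exact (hlt k x).le.trans ((le_abs_self _).trans (hub k x))

/-- If there is an atom at the opening time, the expected wait also jumps upwards after it: just after
`0` all the walk-in customers of the atom are in front, at `0` only some of them. -/
theorem meanWait_lt_rightWait [IsProbabilityMeasure F] (hlam : 0 < lam) (hμ : 0 < μ)
    (hS : StrictMono S) (hS0 : ∀ i, 0 ≤ S i) (hneg : F (Iio 0) = 0) (h : F {0} ≠ 0) :
    meanWait lam μ S F 0 < rightWait lam μ S F 0 := by
  have hae : ∀ᵐ a ∂F, 0 ≤ a := by simpa [ae_iff, Iio_def] using hneg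
  set m := ((List.ofFn S).filter fun a => a ≤ 0).length with hm
  have hrep : ∀ {k : ℕ} (x : Fin k → ℝ), (∀ i, 0 ≤ x i) →
      arrivalsThrough S x 0
        = List.replicate (m + ((List.ofFn x).filter fun a => a ≤ 0).length) 0 := by
    intro k x hx
    rw [List.eq_replicate_iff]
    refine ⟨by rw [arrivalsThrough, length_mergeArrivals, add_comm], fun a ha => ?_⟩
    refine le_antisymm (arrivalsThrough_le a ha) ?_
    rw [arrivalsThrough, mem_mergeArrivals, List.mem_filter, List.mem_filter, List.mem_ofFn',
      List.mem_ofFn'] at ha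
    rcases ha with ⟨⟨i, rfl⟩, _⟩ | ⟨⟨i, rfl⟩, _⟩
    · exact hx i
    · exact hS0 i
  have hrep' : ∀ {k : ℕ} (x : Fin k → ℝ), (∀ i, 0 ≤ x i) →
      arrivalsUpTo S x 0 = List.replicate m 0 := by
    intro k x hx
    have hnil : ((List.ofFn x).filter fun a => a < 0) = [] := by
      rw [List.filter_eq_nil_iff]
      intro a ha
      obtain ⟨i, rfl⟩ := (List.mem_ofFn' x a).1 ha
      simpa using hx i
    rw [List.eq_replicate_iff]
    refine ⟨by rw [arrivalsUpTo_eq, length_mergeArrivals, hnil]; simp [hm], fun a ha => ?_⟩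
    refine le_antisymm (arrivalsUpTo_le a ha) ?_
    rw [arrivalsUpTo_eq, mem_mergeArrivals, hnil, List.mem_filter, List.mem_ofFn'] at ha
    rcases ha with ha | ⟨⟨i, rfl⟩, _⟩
    · simp at ha
    · exact hS0 i
  have e1 : meanWait lam μ S F 0 = tagWait lam μ S F 0 m := by
    rw [meanWait_eq_poisMix hlam.le hμ hS,
      poisMix_congr (g := fun _ _ => tagWait lam μ S F 0 m) fun k => ?_]
    · simp [poisMix, tsum_mul_right, (hasSum_poisMass lam).tsum_eq]
    · filter_upwards [ae_pi_forall hae k] with x hx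
      rw [hrep' x hx, lawMean_replicate]
  have e0 : F.real {a | a ≤ 0} = F.real {0} := by
    refine measureReal_congr ?_
    filter_upwards [hae] with a ha
    exact propext ⟨fun h => le_antisymm h ha, fun h => le_of_eq h⟩
  have e2 : rightWait lam μ S F 0
      = ∑' i, poisMass (lam * F.real {0}) i * expWait μ S 0 (m + i) := by
    rw [← e0, ← poisMix_comp_length_filter (fun a => a ≤ 0) measurableSet_Iic hlam.le
      (φ := fun i => expWait μ S 0 (m + i)) (A := 1 / μ)
      (fun r => expWait_nonneg hμ hS 0 (m + r)) (expWait_add_le hμ hS 0 m), rightWait]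
    refine poisMix_congr fun k => ?_
    filter_upwards [ae_pi_forall hae k] with x hx
    rw [hrep x hx, lawMean_replicate]
  rw [e1, e2]
  exact tsum_tiePos_mul_lt (φ := fun r => expWait μ S 0 (m + r)) (A := 1 / μ)
    (mul_pos hlam (by simpa [Measure.real, ENNReal.toReal_pos_iff, pos_iff_ne_zero] using h))
    (by positivity)
    (fun r => expWait_nonneg hμ hS 0 (m + r)) (expWait_add_le hμ hS 0 m)
    ((expWait_strictMono hμ hS 0).comp fun _ _ h => Nat.add_lt_add_left h m)

/-- The system opens empty. -/
theorem meanWait_zero [IsProbabilityMeasure F] (hlam : 0 ≤ lam) (hμ : 0 < μ)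
    (hS : StrictMono S) (hS0 : ∀ i, 0 < S i) (hneg : F (Iio 0) = 0) (h : F {0} = 0) :
    meanWait lam μ S F 0 = 0 := by
  have hae : ∀ᵐ a ∂F, 0 ≤ a := by simpa [ae_iff, Iio_def] using hneg
  rw [meanWait_of_measure_zero hlam hμ hS h, poisMix_congr (g := fun _ _ => 0) fun k => ?_]
  · simp [poisMix]
  · filter_upwards [ae_pi_forall hae k] with x hx
    have hnil : arrivalsUpTo S x 0 = [] := by
      rw [List.eq_nil_iff_forall_not_mem]
      intro a ha
      rw [arrivalsUpTo_eq, mem_mergeArrivals, List.mem_filter, List.mem_filter, List.mem_ofFn',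
        List.mem_ofFn'] at ha
      rcases ha with ⟨⟨i, rfl⟩, h⟩ | ⟨⟨i, rfl⟩, h⟩
      · exact absurd (hx i) (by simpa using h)
      · exact absurd (hS0 i) (by simpa using h)
    rw [hnil]
    simp [lawMean, expWait_zero]

theorem arrivalsUpTo_ne_nil {x : Fin k → ℝ} {i : Fin k} (h : x i < t) : arrivalsUpTo S x t ≠ [] :=
  List.ne_nil_of_mem (a := x i) (mem_mergeArrivals.2 (Or.inl (by simp [h])))

theorem meanWait_pos [IsProbabilityMeasure F] (hlam : 0 < lam) (hμ : 0 < μ)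
    (hS : StrictMono S) (h : F (Iio t) ≠ 0) : 0 < meanWait lam μ S F t := by
  obtain ⟨K, hK, hb⟩ := exists_tagWait_le (F := F) hlam.le hμ hS t
  have h0 := tagWait_nonneg (F := F) hlam.le hμ hS t
  have hub : ∀ (k : ℕ) (x : Fin k → ℝ), |lawMean μ (arrivalsUpTo S x t) t (tagWait lam μ S F t)|
      ≤ 1 / μ * (k + (M + K)) := fun k x => abs_lawMean_arrivalsUpTo_le hμ x h0 hb arrivalsUpTo_le
  have hz : poisMix lam F (fun _ _ => 0) = 0 := by simp [poisMix]
  rw [meanWait_eq_poisMix hlam.le hμ hS, ← hz]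
  refine poisMix_lt hlam (fun _ => measurable_const)
    (fun k => measurable_lawMean_arrivalsUpTo μ S t t _ k) (A := 1 / μ) (c := M + K)
    (fun k x => ?_) hub (fun k => Eventually.of_forall fun x => ?_) h fun x hx => ?_
  · rw [abs_zero]; positivity
  · rw [← lawMean_const μ (arrivalsUpTo S x t) t 0]
    exact lawMean_mono hμ.le (pairwise_mergeArrivals _ _) arrivalsUpTo_le fun n _ => h0 n
  · refine lawMean_pos hμ (arrivalsUpTo_ne_nil hx) (pairwise_mergeArrivals _ _) arrivalsUpTo_le
      (fun n => ?_) (h0 0)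
    refine lt_of_lt_of_le ?_ (expWait_le_tagWait hlam.le hμ hS t _)
    rw [← expWait_zero μ S t]
    exact expWait_strictMono hμ hS t (Nat.succ_pos n)

/-- The expected wait decreases strictly while nobody arrives, unless the system is certainly
empty. -/
theorem meanWait_lt_of_no_arrivals [IsProbabilityMeasure F] (hlam : 0 < lam) (hμ : 0 < μ)
    (hS : StrictMono S) {a s : ℝ} (has : a < s) (hFa : F {a} = 0) (hFs : F {s} = 0)
    (hFas : F (Ioo a s) = 0) (hSas : ∀ i, S i ∉ Ioc a s) (h : F (Iio a) ≠ 0) :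
    meanWait lam μ S F s < meanWait lam μ S F a := by
  rw [meanWait_of_measure_zero hlam.le hμ hS hFa, meanWait_of_measure_zero hlam.le hμ hS hFs]
  have hw : expWait μ S s = waitList μ ((List.ofFn S).filter fun b => a < b) s := by
    ext n
    unfold expWait
    congr 1
    refine List.filter_congr fun b hb => ?_
    obtain ⟨i, rfl⟩ := (List.mem_ofFn' S b).1 hb
    have := hSas i
    rw [mem_Ioc, not_and, not_le] at this
    simp only [decide_eq_decide]
    exact ⟨fun h => has.trans h, this⟩
  have hL : ∀ k, ∀ᵐ x ∂(Measure.pi fun _ : Fin k => F), arrivalsUpTo S x s = arrivalsUpTo S x a := by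
    intro k
    have hae : ∀ᵐ b ∂F, b ∉ Ico a s := by
      refine measure_eq_zero_iff_ae_notMem.1 ?_
      rw [← Ioo_insert_left has, insert_eq]
      exact measure_union_null hFa hFas
    filter_upwards [ae_pi_forall hae k] with x hx
    rw [arrivalsUpTo_eq, arrivalsUpTo_eq]
    congr 1
    · refine List.filter_congr fun b hb => ?_
      obtain ⟨i, rfl⟩ := (List.mem_ofFn' x b).1 hb
      have := hx i
      rw [mem_Ico, not_and, not_lt] at this
      simp only [decide_eq_decide]
      exact ⟨fun h => by by_contra! hc; exact absurd (this hc) h.not_ge, fun h => h.trans has⟩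
    · refine List.filter_congr fun b hb => ?_
      obtain ⟨i, rfl⟩ := (List.mem_ofFn' S b).1 hb
      have := hSas i
      rw [mem_Ioc, not_and] at this
      simp only [decide_eq_decide]
      exact ⟨fun h => by by_contra! hc; exact this hc h, fun h => h.trans has.le⟩
  rw [poisMix_congr (g := fun _ x => lawMean μ (arrivalsUpTo S x a) s
    (waitList μ ((List.ofFn S).filter fun b => a < b) s)) fun k => by
      filter_upwards [hL k] with x hx
      rw [hx, hw]]
  have hder : ∀ {k : ℕ} (x : Fin k → ℝ) (u : ℝ), HasDerivAt
      (fun u => lawMean μ (arrivalsUpTo S x a) u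
        (waitList μ ((List.ofFn S).filter fun b => a < b) u))
      (-(1 - sizeLaw μ (arrivalsUpTo S x a) u 0)) u := fun x u =>
    hasDerivAt_lawMean _ u _ (fun s => waitList_zero _ _ _) fun n =>
      hasDerivAt_waitList_succ hμ.ne' _ u n
  have hle1 : ∀ {k : ℕ} (x : Fin k → ℝ) (u : ℝ), a ≤ u →
      sizeLaw μ (arrivalsUpTo S x a) u 0 ≤ 1 := fun x u hu => by
    rw [← sum_sizeLaw μ (arrivalsUpTo S x a) u _ (Nat.lt_succ_self _)]
    exact Finset.single_le_sum (f := sizeLaw μ (arrivalsUpTo S x a) u)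
      (fun n _ => sizeLaw_nonneg hμ.le _ u (pairwise_mergeArrivals _ _)
        (fun b hb => (arrivalsUpTo_le b hb).trans hu) n) (by simp)
  have hws := expWait_nonneg hμ hS s
  have hws' := expWait_le hμ hS s
  rw [hw] at hws hws'
  refine poisMix_lt hlam (fun k => measurable_lawMean_arrivalsUpTo μ S a s _ k)
    (fun k => measurable_lawMean_arrivalsUpTo μ S a a _ k) (A := 1 / μ) (c := M + M)
    (fun k x => abs_lawMean_arrivalsUpTo_le hμ x hws hws'
      fun b hb => (arrivalsUpTo_le b hb).trans has.le)
    (fun k x => abs_lawMean_arrivalsUpTo_le hμ x (expWait_nonneg hμ hS a) (expWait_le hμ hS a)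
      arrivalsUpTo_le) (fun k => Eventually.of_forall fun x => ?_) h fun x hx => ?_
  · refine antitoneOn_of_deriv_nonpos (convex_Icc a s)
      (fun u _ => (hder x u).continuousAt.continuousWithinAt)
      (fun u _ => (hder x u).differentiableAt.differentiableWithinAt) (fun u hu => ?_)
      (left_mem_Icc.2 has.le) (right_mem_Icc.2 has.le) has.le
    rw [interior_Icc] at hu
    rw [(hder x u).deriv]
    linarith [hle1 x u hu.1.le]
  · refine strictAntiOn_of_deriv_neg (convex_Icc a s)
      (fun u _ => (hder x u).continuousAt.continuousWithinAt) (fun u hu => ?_)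
      (left_mem_Icc.2 has.le) (right_mem_Icc.2 has.le) has
    rw [interior_Icc] at hu
    rw [(hder x u).deriv]
    linarith [sizeLaw_zero_lt_one hμ (arrivalsUpTo S x a) u (arrivalsUpTo_ne_nil hx)
      (pairwise_mergeArrivals _ _) fun b hb => (arrivalsUpTo_le b hb).trans hu.1.le]

end oneSided

end limits

/-! ### The cumulative distribution function and gaps -/

/-- A gap is determined by its left end point. -/
theorem encard_isGap_le {M : ℕ} {T : ℝ} {F : Measure ℝ} {S : Fin M → ℝ}
    (h : ∀ a b, IsGap T F a b → a = 0 ∨ ∃ i, a = S i) :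
    {g : ℝ × ℝ | IsGap T F g.1 g.2}.encard ≤ M + 1 := by
  have hinj : InjOn Prod.fst {g : ℝ × ℝ | IsGap T F g.1 g.2} := by
    rintro ⟨a, b⟩ ⟨hab, hb⟩ ⟨a', b'⟩ ⟨hab', hb'⟩ (rfl : a = a')
    have hI : Icc a b = Icc a b' := hb.trans hb'.symm
    have h1 : b ∈ Icc a b' := hI ▸ right_mem_Icc.2 hab.le
    have h2 : b' ∈ Icc a b := hI ▸ right_mem_Icc.2 hab'.le
    exact Prod.ext rfl (le_antisymm h1.2 h2.2)
  rw [← hinj.encard_image]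
  calc (Prod.fst '' {g : ℝ × ℝ | IsGap T F g.1 g.2}).encard
      ≤ (insert 0 (range S)).encard := by
        refine encard_le_encard ?_
        rintro _ ⟨g, hg, rfl⟩
        rcases h _ _ hg with h0 | ⟨i, hi⟩
        · exact Or.inl h0
        · exact Or.inr ⟨i, hi.symm⟩
    _ ≤ (range S).encard + 1 := encard_insert_le _ _
    _ ≤ M + 1 := by
        gcongr
        rw [← image_univ]
        refine (encard_image_le S univ).trans ?_
        simp

section cdf

variable {F : Measure ℝ} [IsProbabilityMeasure F] {T : ℝ}

theorem measure_Ioc_eq_cdf (a b : ℝ) : F (Ioc a b) = ENNReal.ofReal (cdf F b - cdf F a) := by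
  conv_lhs => rw [← measure_cdf F]
  exact (cdf F).measure_Ioc a b

theorem continuousOn_cdf (h : ∀ t, 0 < t → F {t} = 0) : ContinuousOn (cdf F) (Icc 0 T) := by
  intro x hx
  rcases hx.1.eq_or_lt with rfl | hpos
  · exact ((cdf F).right_continuous 0).mono Icc_subset_Ici_self
  · have hl : ContinuousWithinAt (cdf F) (Iio x) x := by
      rw [(monotone_cdf F).continuousWithinAt_Iio_iff_leftLim_eq]
      have h0 : ENNReal.ofReal (cdf F x - Function.leftLim (cdf F) x) = 0 := by
        rw [← (cdf F).measure_singleton, measure_cdf, h x hpos]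
      rw [ENNReal.ofReal_eq_zero, sub_nonpos] at h0
      exact le_antisymm ((monotone_cdf F).leftLim_le le_rfl) h0
    have hr : ContinuousWithinAt (cdf F) (Ioi x) x :=
      ((cdf F).right_continuous x).mono Ioi_subset_Ici_self
    exact (continuousAt_iff_continuous_left'_right'.2 ⟨hl, hr⟩).continuousWithinAt

/-- A level set of the distribution function is compact and connected, since there are no atoms in
`(0, ∞)` and the distribution function is right continuous at `0`. -/
theorem exists_isGap_of_measure_Ioo (h : ∀ t, 0 < t → F {t} = 0) {t b : ℝ} (ht : 0 ≤ t)
    (htT : t < T) (htb : t < b) (hF : F (Ioo t b) = 0) :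
    ∃ a c, IsGap T F a c ∧ t ∈ Icc a c := by
  set L : Set ℝ := {x | x ∈ Icc 0 T ∧ cdf F x = cdf F t} with hL
  have hmono := monotone_cdf F
  have htL : t ∈ L := ⟨⟨ht, htT.le⟩, rfl⟩
  have hconn : IsConnected L := by
    refine ⟨⟨t, htL⟩, OrdConnected.isPreconnected ⟨fun x hx y hy z hz => ⟨⟨hx.1.1.trans hz.1,
      hz.2.trans hy.1.2⟩, le_antisymm ?_ ?_⟩⟩⟩
    · exact (hmono hz.2).trans hy.2.le
    · exact hx.2.ge.trans (hmono hz.1)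
  have hcomp : IsCompact L :=
    isCompact_Icc.of_isClosed_subset
      ((continuousOn_cdf (T := T) h).preimage_isClosed_of_isClosed isClosed_Icc
        (isClosed_singleton (x := cdf F t))) fun x hx => hx.1
  have hIcc := eq_Icc_of_connected_compact hconn hcomp
  obtain ⟨s, hts, hsb⟩ := exists_between (lt_min htb htT)
  have hsL : s ∈ L := by
    refine ⟨⟨ht.trans hts.le, (hsb.trans_le (min_le_right _ _)).le⟩, ?_⟩
    have h0 : F (Ioc t s) = 0 :=
      measure_mono_null (fun x (hx : x ∈ Ioc t s) =>
        (⟨hx.1, hx.2.trans_lt (hsb.trans_le (min_le_left _ _))⟩ : x ∈ Ioo t b)) hF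
    rw [measure_Ioc_eq_cdf, ENNReal.ofReal_eq_zero, sub_nonpos] at h0
    exact le_antisymm h0 (hmono hts.le)
  have htI := htL
  have hsI := hsL
  rw [hIcc] at htI hsI
  have haL : sInf L ∈ L := by
    rw [hIcc, csInf_Icc (htI.1.trans htI.2)]
    exact left_mem_Icc.2 (htI.1.trans htI.2)
  refine ⟨sInf L, sSup L, ⟨htI.1.trans_lt (hts.trans_le hsI.2), ?_⟩, htI⟩
  rw [haL.2, ← hIcc]

end cdf

/-! ### Equilibria -/

section equilibrium

open Filter Topology

variable {M : ℕ} {lam μ T E : ℝ} {S : Fin M → ℝ} {F : Measure ℝ}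

theorem neBot_nhdsLT_inf_nonatoms (F : Measure ℝ) [SFinite F] (t : ℝ) :
    (𝓝[<] t ⊓ 𝓟 {s | F {s} = 0}).NeBot := by
  have hc : {s : ℝ | 0 < F {s}}.Countable :=
    Measure.countable_meas_pos_of_disjoint_iUnion (fun s => measurableSet_singleton s)
      fun s s' h => by simpa using h
  have hd := hc.dense_compl ℝ
  rw [inf_principal_neBot_iff]
  intro U hU
  obtain ⟨b, hb, hbU⟩ := mem_nhdsLT_iff_exists_Ioo_subset.1 hU
  obtain ⟨c, hc, hc'⟩ := hd.exists_between hb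
  exact ⟨c, hbU hc', by simpa using hc⟩

theorem measure_Iio_zero (hsupp : F (Icc 0 T)ᶜ = 0) : F (Iio 0) = 0 :=
  measure_mono_null (show Iio (0 : ℝ) ⊆ (Icc 0 T)ᶜ from fun _ hx h => absurd h.1 (not_le.2 hx))
    hsupp

theorem le_leftWait [IsProbabilityMeasure F] (hlam : 0 ≤ lam) (hμ : 0 < μ) (hS : StrictMono S)
    (hge : ∀ t ∈ Icc 0 T, E ≤ meanWait lam μ S F t) {t : ℝ} (ht : t ∈ Ioc 0 T) :
    E ≤ leftWait lam μ S F t := by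
  have := neBot_nhdsLT_inf_nonatoms F t
  refine ge_of_tendsto (tendsto_leftWait hlam hμ hS t) ?_
  filter_upwards [mem_inf_of_left (Ioo_mem_nhdsLT ht.1)] with s hs
  exact hge s ⟨hs.1.le, hs.2.le.trans ht.2⟩

theorem exists_mem_of_ae_of_measure_ne_zero {p : ℝ → Prop} (h : ∀ᵐ t ∂F, p t) {B : Set ℝ} (hB : F B ≠ 0) :
    ∃ t ∈ B, p t := by
  by_contra! hc
  exact hB (measure_mono_null (fun t ht => hc t ht) (ae_iff.1 h))

/-- An equilibrium has no atom after the opening time: coming just before it would be better. -/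
theorem measure_singleton_eq_zero [IsProbabilityMeasure F] (hlam : 0 < lam) (hμ : 0 < μ)
    (hS : StrictMono S) (hsupp : F (Icc 0 T)ᶜ = 0)
    (hge : ∀ t ∈ Icc 0 T, E ≤ meanWait lam μ S F t)
    (hae : ∀ᵐ t ∂F, meanWait lam μ S F t = E) {t : ℝ} (ht : 0 < t) : F {t} = 0 := by
  by_contra hF
  obtain ⟨s, hs, hE, htT⟩ := exists_mem_of_ae_of_measure_ne_zero
    (hae.and (measure_eq_zero_iff_ae_notMem.1 hsupp)) hF
  rw [mem_singleton_iff.1 hs] at hE htT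
  have h1 := le_leftWait hlam.le hμ hS hge (t := t) ⟨ht, (not_not.1 htT).2⟩
  have h2 := leftWait_lt_meanWait hlam hμ hS (Or.inl hF)
  linarith

/-- Nobody comes right after a time at which the wait is too long. -/
theorem exists_isGap_of_lt_rightWait [IsProbabilityMeasure F] (hlam : 0 < lam) (hμ : 0 < μ)
    (hS : StrictMono S) (hna : ∀ t, 0 < t → F {t} = 0)
    (hae : ∀ᵐ t ∂F, meanWait lam μ S F t = E) {t : ℝ} (ht : 0 ≤ t) (htT : t < T)
    (hE : E < rightWait lam μ S F t) : ∃ a b, IsGap T F a b ∧ t ∈ Icc a b := by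
  have hle : 𝓝[>] t ≤ 𝓝[>] t ⊓ 𝓟 {s | F {s} = 0} := by
    refine le_inf le_rfl (le_principal_iff.2 ?_)
    filter_upwards [self_mem_nhdsWithin] with s hs
    exact hna s (lt_of_le_of_lt ht hs)
  have hev := ((tendsto_rightWait (F := F) hlam.le hμ hS t).mono_left hle).eventually
    (lt_mem_nhds hE)
  obtain ⟨b, hb, hbU⟩ := mem_nhdsGT_iff_exists_Ioo_subset.1 hev
  refine exists_isGap_of_measure_Ioo hna ht htT hb ?_
  by_contra hF
  obtain ⟨s, hs, hsE⟩ := exists_mem_of_ae_of_measure_ne_zero hae hF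
  exact absurd hsE (ne_of_gt (hbU hs))

/-- If a gap started at a positive time that is not scheduled, the expected wait there would be the
equilibrium level `E`, as a limit from the left of times that are in use, and it would fall below
`E` inside the gap. -/
theorem isGap_left_eq [IsProbabilityMeasure F] (hlam : 0 < lam) (hμ : 0 < μ)
    (hS : StrictMono S) (hna : ∀ t, 0 < t → F {t} = 0)
    (hge : ∀ t ∈ Icc 0 T, E ≤ meanWait lam μ S F t)
    (hae : ∀ᵐ t ∂F, meanWait lam μ S F t = E) {a b : ℝ} (hgap : IsGap T F a b) :
    a = 0 ∨ ∃ i, a = S i := by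
  by_contra! hc
  obtain ⟨hab, hI⟩ := hgap
  have haL : a ∈ Icc a b := left_mem_Icc.2 hab.le
  have hbL : b ∈ Icc a b := right_mem_Icc.2 hab.le
  rw [hI] at haL hbL
  have ha : 0 < a := lt_of_le_of_ne haL.1.1 (Ne.symm hc.1)
  have hSa : ∀ i, S i ≠ a := fun i h => hc.2 i h.symm
  have hmass : ∀ x, 0 ≤ x → x < a → F (Ioo x a) ≠ 0 := by
    intro x hx hxa h0
    have h1 : F (Ioc x a) = 0 := by
      rw [← Ioo_insert_right hxa, insert_eq]
      exact measure_union_null (hna a ha) h0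
    rw [measure_Ioc_eq_cdf, ENNReal.ofReal_eq_zero, sub_nonpos] at h1
    have hxL : x ∈ Icc a b := by
      rw [hI]
      exact ⟨⟨hx, hxa.le.trans haL.1.2⟩, le_antisymm (monotone_cdf F hxa.le) h1⟩
    exact absurd hxL.1 hxa.not_ge
  have hle : 𝓝[<] a ≤ 𝓝[<] a ⊓ 𝓟 {s | F {s} = 0} := by
    refine le_inf le_rfl (le_principal_iff.2 ?_)
    filter_upwards [Ioo_mem_nhdsLT ha] with s hs
    exact hna s hs.1
  have hfreq : ∃ᶠ s in 𝓝[<] a, meanWait lam μ S F s ∈ ({E} : Set ℝ) := by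
    rw [frequently_iff]
    intro U hU
    obtain ⟨c, hc, hcU⟩ := mem_nhdsLT_iff_exists_Ioo_subset.1 hU
    obtain ⟨s, hs, hsE⟩ := exists_mem_of_ae_of_measure_ne_zero hae
      (hmass (max c 0) (le_max_right _ _) (max_lt hc ha))
    exact ⟨s, hcU ⟨(le_max_left _ _).trans_lt hs.1, hs.2⟩, hsE⟩
  have hEa : leftWait lam μ S F a = E := isClosed_singleton.mem_of_frequently_of_tendsto hfreq
    ((tendsto_leftWait hlam.le hμ hS a).mono_left hle)
  rw [leftWait_eq_meanWait hlam.le hμ hS (hna a ha) hSa] at hEa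
  have hev : ∀ᶠ s in 𝓝[>] a, (∀ i, (S i ≤ s ↔ S i ≤ a)) ∧ s ∈ Ioo a b :=
    (eventually_all.2 fun i => eventually_right_le_iff a (S i)).and (Ioo_mem_nhdsGT hab)
  obtain ⟨s, hsS, hs⟩ := hev.exists
  have hFab : F (Ioc a b) = 0 := by
    rw [measure_Ioc_eq_cdf, hbL.2, sub_self, ENNReal.ofReal_zero]
  have hlt := meanWait_lt_of_no_arrivals hlam hμ hS hs.1 (hna a ha) (hna s (ha.trans hs.1))
    (measure_mono_null (fun x (hx : x ∈ Ioo a s) =>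
      (⟨hx.1, hx.2.le.trans hs.2.le⟩ : x ∈ Ioc a b)) hFab)
    (fun i hi => absurd ((hsS i).1 hi.2) hi.1.not_ge)
    (fun h0 => hmass 0 le_rfl ha (measure_mono_null (fun x hx => hx.2) h0))
  have := hge s ⟨(ha.trans hs.1).le, hs.2.le.trans hbL.1.2⟩
  linarith

/-- If nobody is scheduled at `0` and there is no atom there, a walk-in customer coming at `0` does
not wait at all, while almost all of the others do. -/
theorem measure_singleton_zero_ne_zero [IsProbabilityMeasure F] (hlam : 0 < lam) (hμ : 0 < μ)
    (hT : 0 < T) (hS : StrictMono S) (hS0 : ∀ i, 0 < S i) (hsupp : F (Icc 0 T)ᶜ = 0) (hE : 0 ≤ E)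
    (hna : ∀ t, 0 < t → F {t} = 0) (hge : ∀ t ∈ Icc 0 T, E ≤ meanWait lam μ S F t)
    (hae : ∀ᵐ t ∂F, meanWait lam μ S F t = E) : F {0} ≠ 0 := by
  intro h0
  have hneg := measure_Iio_zero hsupp
  have hE0 : E = 0 := by
    refine le_antisymm ?_ hE
    rw [← meanWait_zero (F := F) (lam := lam) hlam.le hμ hS hS0 hneg h0]
    exact hge 0 (left_mem_Icc.2 hT.le)
  have hc0 : cdf F 0 = 0 := by
    have : F (Iic 0) = 0 := by
      rw [← Iio_insert, insert_eq]
      exact measure_union_null h0 hneg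
    rw [cdf_eq_real, Measure.real, this, ENNReal.toReal_zero]
  have hcT : cdf F T = 1 := by
    have h1 : F (Iic T)ᶜ = 0 :=
      measure_mono_null (compl_subset_compl.2 Icc_subset_Iic_self) hsupp
    rw [cdf_eq_real, Measure.real, (prob_compl_eq_zero_iff measurableSet_Iic).1 h1,
      ENNReal.toReal_one]
  obtain ⟨c, hc, hc2⟩ := intermediate_value_Icc hT.le (continuousOn_cdf hna)
    (show (1 / 2 : ℝ) ∈ Icc (cdf F 0) (cdf F T) by rw [hc0, hcT]; norm_num)
  have hpos : F (Ioc c T) ≠ 0 := by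
    rw [measure_Ioc_eq_cdf, hcT, hc2]
    norm_num
  obtain ⟨t, ht, htE⟩ := exists_mem_of_ae_of_measure_ne_zero hae hpos
  have hFt : F (Iio t) ≠ 0 := by
    intro hz
    have : F (Iic c) = 0 := measure_mono_null (fun x hx => lt_of_le_of_lt hx ht.1) hz
    rw [cdf_eq_real, Measure.real, this] at hc2
    norm_num at hc2
  have := meanWait_pos hlam hμ hS hFt
  linarith

end equilibrium

theorem proposition2 (M : ℕ) (lam μ T : ℝ) (hlam : 0 < lam) (hμ : 0 < μ) (hT : 0 < T)
    (S : Fin M → ℝ) (hS : StrictMono S) (hST : ∀ i, S i ∈ Icc 0 T)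
    (F : Measure ℝ) (hF : IsEquilibrium lam μ T S F) :
    {g : ℝ × ℝ | IsGap T F g.1 g.2}.encard ≤ M + 1 ∧
    (∀ a b, IsGap T F a b → a = 0 ∨ ∃ i, a = S i) ∧
    (∀ i, 0 < S i → S i < T → ∃ a b, IsGap T F a b ∧ S i ∈ Icc a b) ∧
    ((∀ i, 0 < S i) → ∃ a b, IsGap T F a b ∧ 0 ∈ Icc a b) := by
  obtain ⟨hprob, hsupp, E, hE, hge, hae⟩ := hF
  have hna : ∀ t, 0 < t → F {t} = 0 := fun t ht =>
    measure_singleton_eq_zero hlam hμ hS hsupp hge hae ht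
  have hstart : ∀ a b, IsGap T F a b → a = 0 ∨ ∃ i, a = S i := fun a b h =>
    isGap_left_eq hlam hμ hS hna hge hae h
  refine ⟨encard_isGap_le hstart, hstart, fun i hi0 hiT => ?_, fun hS0 => ?_⟩
  · refine exists_isGap_of_lt_rightWait hlam hμ hS hna hae hi0.le hiT ?_
    rw [rightWait_eq_meanWait hlam.le hμ hS (hna _ hi0)]
    exact (le_leftWait hlam.le hμ hS hge ⟨hi0, hiT.le⟩).trans_lt
      (leftWait_lt_meanWait hlam hμ hS (Or.inr ⟨i, rfl⟩))
  · have hF0 := measure_singleton_zero_ne_zero hlam hμ hT hS hS0 hsupp hE hna hge hae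
    obtain ⟨_, rfl, hE0⟩ := exists_mem_of_ae_of_measure_ne_zero hae hF0
    refine exists_isGap_of_lt_rightWait hlam hμ hS hna hae le_rfl hT ?_
    rw [← hE0]
    exact meanWait_lt_rightWait hlam hμ hS (fun i => (hS0 i).le)
      (measure_Iio_zero hsupp) hF0
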